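/- Let $q\ge 9$ be an odd prime power, let $\beta\in\mathrm{GF}(q^2)$ be a primitive $(q+1)$-th root of unity, and let $\mathbb{M}_{\gamma}(x)$ denote the minimal polynomial of $\gamma$ over $\mathrm{GF}(q)$. An $[n,k,d]$ code over $\mathrm{GF}(q)$ is a $k$-dimensional linear subspace of $\mathrm{GF}(q)^n$ with minimum Hamming distance $d$; $\mathcal{C}^\perp$ denotes the Euclidean dual of $\mathcal{C}$. A cyclic code of length $n$ with generator polynomial $g(x)$ is the set of $(c_0,\ldots,c_{n-1})\in \mathrm{GF}(q)^n$ for which $\sum_i c_ix^i$ lies in the ideal of $\mathrm{GF}(q)[x]/(x^n-1)$ generated by $g(x)$. Let $\mathcal{C}_4$ be the cyclic code of length $q+1$ over $\mathrm{GF}(q)$ with generator polynomial $\mathbb{M}_{\beta^4}(x)\mathbb{M}_{\beta^5}(x)\cdots\mathbb{M}_{\beta^{(q+1)/2}}(x)$, and let $$\overline{\mathcal{C}_4}=\Big\{(c_0,\ldots,c_{q+1})\in\mathrm{GF}(q)^{q+2}:\ (c_0,\ldots,c_q)\in\mathcal{C}_4,\ \sum_{i=0}^{q+1}c_i=0\Big\}$$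 be its extended code. Let $\mathcal{C}_{(q,q+1,4,1)}$ be the narrow-sense BCH code of length $q+1$ over $\mathrm{GF}(q)$ with designed distance $4$, that is, the cyclic code with generator polynomial $\mathrm{lcm}(\mathbb{M}_{\beta}(x),\mathbb{M}_{\beta^2}(x),\mathbb{M}_{\beta^3}(x))$, and let $\mathcal{C}(4)=(\mathcal{C}_{(q,q+1,4,1)})^\perp$. Then the following hold. (A) $\overline{\mathcal{C}_4}$ has parameters $[q+2,7,q-5]$ and $(\overline{\mathcal{C}_4})^\perp$ has parameters $[q+2,q-5,d]$, where 1. if $4\mid (q+1)$, then $d=5$; 2. if $4\mid (q-1)$ and $3\nmid (q+1)$, then $d=6$; 3. if $4\mid (q-1)$ and $3\mid (q+1)$, then $6\le d\le 7$, and $d=6$ provided that $5\nmid q$. (B) $\mathcal{C}(4)$ has parameters $[q+1,6,q-5]$ and $\mathcal{C}_{(q,q+1,4,1)}$ has parameters $[q+1,q-5,d']$, where 1. if $4\mid (q+1)$, then $d'=4$; 2. if $4\mid (q-1)$ and $3\nmid (q+1)$, then $d'=5$; 3. if $4\mid (q-1)$ and $3\mid (q+1)$, then $5\le d'\le 6$,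 and $d'=5$ provided that $5\nmid q$. -/

import Mathlib

open Polynomial

noncomputable section

open Classical in
/-- The minimum Hamming distance of the code `C` is `d`. -/
def HasMinDist {F : Type*} [Field F] {n : ℕ} (C : Submodule F (Fin n → F)) (d : ℕ) : Prop :=
  IsLeast {w : ℕ | ∃ x ∈ C, ∃ y ∈ C, x ≠ y ∧ hammingDist x y = w} d

/-- `C` is an `[n, k, d]` code: a `k`-dimensional linear subspace of `Fⁿ` with minimum Hamming
distance `d`. -/
def IsCodeWithParams {F : Type*} [Field F] (n k d : ℕ) (C : Submodule F (Fin n → F)) : Prop :=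
  Module.finrank F C = k ∧ HasMinDist C d

/-- The (Euclidean) dual code `C^⊥`. -/
def dualCode {F : Type*} [Field F] {n : ℕ} (C : Submodule F (Fin n → F)) :
    Submodule F (Fin n → F) :=
  C.orthogonalBilin (dotProductBilin F F)

/-- The extended code: words `(c_0, …, c_n)` with `(c_0, …, c_{n-1}) ∈ C` and `∑ c_i = 0`. -/
def extendedCode {F : Type*} [Field F] {n : ℕ} (C : Submodule F (Fin n → F)) :
    Submodule F (Fin (n + 1) → F) where
  carrier := {c | (fun i : Fin n => c i.castSucc) ∈ C ∧ ∑ i, c i = 0}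
  zero_mem' := ⟨C.zero_mem, by simp⟩
  add_mem' := by
    rintro a b ⟨ha, ha'⟩ ⟨hb, hb'⟩
    exact ⟨C.add_mem ha hb, by simp [Finset.sum_add_distrib, ha', hb']⟩
  smul_mem' := by
    rintro r a ⟨ha, ha'⟩
    exact ⟨C.smul_mem r ha, by simp [← Finset.mul_sum, ha']⟩

/-- The polynomial `c_0 + c_1 x + ⋯ + c_{n-1} x^{n-1}` of a word. -/
def wordPoly {F : Type*} [Field F] {n : ℕ} (c : Fin n → F) : F[X] :=
  ∑ i, C (c i) * X ^ (i : ℕ)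

/-- The cyclic code of length `n` generated by `g`: the words whose class in `F[x]/(x^n - 1)`
lies in the ideal generated by the class of `g`. -/
def cyclicCode {F : Type*} [Field F] (n : ℕ) (g : F[X]) : Submodule F (Fin n → F) where
  carrier := {c | Ideal.Quotient.mk (Ideal.span {(X ^ n - 1 : F[X])}) (wordPoly c) ∈
    Ideal.span {Ideal.Quotient.mk (Ideal.span {(X ^ n - 1 : F[X])}) g}}
  zero_mem' := by simp [wordPoly]
  add_mem' := by
    intro a b ha hb
    have h : wordPoly (a + b) = wordPoly a + wordPoly b := by
      simp [wordPoly, add_mul, Finset.sum_add_distrib]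
    simp only [Set.mem_ofPred_eq] at ha hb ⊢
    rw [h, map_add]
    exact Ideal.add_mem _ ha hb
  smul_mem' := by
    intro r a ha
    have h : wordPoly (r • a) = C r * wordPoly a := by
      simp [wordPoly, Finset.mul_sum, mul_assoc]
    simp only [Set.mem_ofPred_eq] at ha ⊢
    rw [h, map_mul]
    exact Ideal.mul_mem_left _ _ ha

/-- The code `C_u`: the cyclic code of length `q + 1` over `F = GF(q)` with generator polynomial
`M_{β^u}(x) M_{β^{u+1}}(x) ⋯ M_{β^{⌊(q+1)/2⌋}}(x)`, where `M_γ` is the minimal polynomial of `γ`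
over `F` and `β ∈ K = GF(q²)` is a primitive `(q+1)`-th root of unity. -/
def classicalMDSCode (F : Type*) {K : Type*} [Field F] [Field K] [Algebra F K]
    (q : ℕ) (β : K) (u : ℕ) : Submodule F (Fin (q + 1) → F) :=
  cyclicCode (q + 1) (∏ i ∈ Finset.Icc u ((q + 1) / 2), minpoly F (β ^ i))

open Classical in
/-- The narrow-sense BCH code of length `n` over `F` with designed distance `δ`: the cyclic code
with generator polynomial `lcm (M_β(x), M_{β^2}(x), …, M_{β^{δ-1}}(x))`, where `β` is a primitive
`n`-th root of unity in an extension of `F`. -/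
def narrowSenseBCHCode (F : Type*) {K : Type*} [Field F] [Field K] [Algebra F K]
    (n : ℕ) (β : K) (δ : ℕ) : Submodule F (Fin n → F) :=
  cyclicCode n ((Finset.Icc 1 (δ - 1)).lcm fun i => minpoly F (β ^ i))

end

/-! Let U be the group of (q+1)-th roots of unity in K; the q-th power map inverts U. A word c : U →
F of the BCH code satisfies ∑ c(u) uⁱ = 0 for i = 1, 2, 3, hence by Frobenius also for i = -1, -2,
-3. So on polynomials P of degree at most 6 the functional ∑ c(u) u⁻³ P(u) equals ∑ c(u) times the
coefficient of X³ (`bch_sum_mul_eval`). Testing it on products of linear factors shows that a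
nonzero word of weight at most 7 has weight at least 4 and ∑ c(u) ≠ 0.

The BCH code is dual to the trace words Tr(a₁u + a₂u² + a₃u³), and the extended code consists of the
words a₀ + Tr(...) followed by -a₀. Times u³, such a word is a polynomial of degree at most 6, so it
has at most six zeros on U, and six are attained. The dual of the extended code is the BCH code with
the coordinate ∑ c(u) appended; this is nonzero on words of small weight, so the distance grows by
one.

Weight 4 forces the support to be a coset of the fourth roots of unity, which lie in U iff 4 ∣ q+1.
If 4 ∣ q-1, weight 5 is always attained: it suffices to find five points of U whose monic quintic
has no X³ and no X² term. The fifth roots of unity serve if 5 ∣ q+1; otherwise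
(X-1)(X²-sX+1)(X²-tX+1) with (s+1)(t+1) = -1 does. Finding s amounts to making two quadratics in σ =
s+1 nonsquare at once (`exists_nonsquare_pair`), which follows from second moments of character sums
and a few small fields. -/

/-! ### Quadratic character sums and their second moments. -/

section CharacterSums

variable {F : Type*} [Field F] [Fintype F] [DecidableEq F]

theorem quadraticChar_mul_self_eq_ite (a : F) :
    quadraticChar F a * quadraticChar F a = if a = 0 then 0 else 1 := by
  split_ifs with h
  · simp [h]
  · rw [← sq, quadraticChar_sq_one h]

theorem quadraticChar_abs_le (a : F) : quadraticChar F a ≤ 1 ∧ -1 ≤ quadraticChar F a := by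
  by_cases h : a = 0
  · simp [h]
  · rcases quadraticChar_dichotomy h with h | h <;> simp [h]

/-- For a ≠ b an affine substitution turns the sum into χ(-1) J(χ, χ), and J(χ, χ⁻¹) = -χ(-1). -/
theorem sum_quadraticChar_sub_mul_sub (hF : ringChar F ≠ 2) (a b : F) :
    ∑ x, quadraticChar F (x - a) * quadraticChar F (x - b) =
      (if a = b then (Fintype.card F : ℤ) else 0) - 1 := by
  split_ifs with h
  · subst h
    rw [Fintype.sum_equiv (Equiv.subRight a) _ (fun x => if x = 0 then (0 : ℤ) else 1)
      (fun x => quadraticChar_mul_self_eq_ite (x - a))]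
    have : ∀ x : F, (if x = 0 then (0 : ℤ) else 1) = 1 - if x = 0 then 1 else 0 := by
      intro x; split_ifs <;> simp
    simp [this]
  · have hab : a - b ≠ 0 := sub_ne_zero.mpr h
    have key := jacobiSum_nontrivial_inv (quadraticChar_ne_one hF)
    rw [(quadraticChar_isQuadratic F).inv, jacobiSum] at key
    let e : F ≃ F :=
      (Equiv.mulRight₀ (-(a - b)) (neg_ne_zero.mpr hab)).trans (Equiv.addRight a)
    have h1 : ∑ x, quadraticChar F (x - a) * quadraticChar F (x - b) =
        quadraticChar F (-1) * ∑ x, quadraticChar F x * quadraticChar F (1 - x) := by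
      rw [← Equiv.sum_comp e, Finset.mul_sum]
      refine Finset.sum_congr rfl fun x _ => ?_
      have e1 : e x - a = x * (-1) * (a - b) := by simp [e]; ring
      have e2 : e x - b = (1 - x) * (a - b) := by simp [e]; ring
      rw [e1, e2, map_mul, map_mul, map_mul]
      have := quadraticChar_sq_one hab
      linear_combination quadraticChar F x * quadraticChar F (-1) * quadraticChar F (1 - x) * this
    rw [h1, key]
    have := quadraticChar_sq_one (F := F) (a := -1) (by simp)
    linear_combination -this

/-- Expand the square: every pair (x, y) contributes -1, and only the diagonal carries an extra q.
-/
theorem sum_sq_sum_mul_quadraticChar (hF : ringChar F ≠ 2) (c : F → ℤ) :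
    ∑ a, (∑ x, c x * quadraticChar F (x - a)) ^ 2 =
      Fintype.card F * ∑ x, c x ^ 2 - (∑ x, c x) ^ 2 := by
  have h1 : ∀ a : F, (∑ x, c x * quadraticChar F (x - a)) ^ 2 =
      ∑ x, ∑ y, c x * c y * (quadraticChar F (a - x) * quadraticChar F (a - y)) := by
    intro a
    rw [sq, Finset.sum_mul_sum]
    refine Finset.sum_congr rfl fun x _ => Finset.sum_congr rfl fun y _ => ?_
    have e : ∀ z : F, quadraticChar F (z - a) = quadraticChar F (-1) * quadraticChar F (a - z) := by
      intro z; rw [← map_mul]; congr 1; ring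
    have := quadraticChar_sq_one (F := F) (a := -1) (by simp)
    rw [e x, e y]
    linear_combination c x * c y * quadraticChar F (a - x) * quadraticChar F (a - y) * this
  simp_rw [h1]
  rw [Finset.sum_comm]
  have h2 : ∀ x : F, ∑ a : F, ∑ y, c x * c y * (quadraticChar F (a - x) * quadraticChar F (a - y))
      = Fintype.card F * c x ^ 2 - c x * ∑ y, c y := by
    intro x
    rw [Finset.sum_comm]
    simp_rw [← Finset.mul_sum, sum_quadraticChar_sub_mul_sub hF]
    simp_rw [mul_sub, Finset.sum_sub_distrib, mul_one]
    simp only [mul_ite, mul_zero, Finset.sum_ite_eq, Finset.mem_univ, if_true]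
    rw [Finset.mul_sum]
    ring
  simp_rw [h2]
  rw [Finset.sum_sub_distrib, ← Finset.mul_sum, ← Finset.sum_mul]
  ring

/-- The sums attached to the twists `y² = x³ - c x` have mean square at most `2 q`. -/
theorem sum_sq_sum_quadraticChar_mul_sq_sub (hF : ringChar F ≠ 2)
    (hm1 : quadraticChar F (-1) = 1) :
    ∑ c, (∑ x, quadraticChar F x * quadraticChar F (x ^ 2 - c)) ^ 2 ≤
      2 * (Fintype.card F : ℤ) * Fintype.card F := by
  have h1 : ∀ a : F, (∑ x, quadraticChar F x * quadraticChar F (x ^ 2 - a)) ^ 2 =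
      ∑ x, ∑ y, quadraticChar F x * quadraticChar F y *
        (quadraticChar F (a - x ^ 2) * quadraticChar F (a - y ^ 2)) := by
    intro a
    rw [sq, Finset.sum_mul_sum]
    refine Finset.sum_congr rfl fun x _ => Finset.sum_congr rfl fun y _ => ?_
    have e : ∀ z : F, quadraticChar F (z ^ 2 - a) = quadraticChar F (a - z ^ 2) := by
      intro z; rw [← one_mul (quadraticChar F (a - z ^ 2)), ← hm1, ← map_mul]; congr 1; ring
    rw [e x, e y]
    ring
  simp_rw [h1]
  rw [Finset.sum_comm]
  have h2 : ∀ x : F, ∑ a : F, ∑ y, quadraticChar F x * quadraticChar F y *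
        (quadraticChar F (a - x ^ 2) * quadraticChar F (a - y ^ 2)) ≤ 2 * Fintype.card F := by
    intro x
    rw [Finset.sum_comm]
    simp_rw [← Finset.mul_sum, sum_quadraticChar_sub_mul_sub hF]
    simp_rw [mul_sub, Finset.sum_sub_distrib, mul_one]
    rw [← Finset.mul_sum, quadraticChar_sum_zero hF, mul_zero, sub_zero]
    -- The -1 terms have cancelled because ∑ χ(y) = 0; only y = ±x remain, each worth at most q.
    calc _ ≤ ∑ y : F, ((if y = x then (Fintype.card F : ℤ) else 0)
          + if y = -x then (Fintype.card F : ℤ) else 0) := by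
          refine Finset.sum_le_sum fun y _ => ?_
          obtain ⟨hx, hx'⟩ := quadraticChar_abs_le x
          obtain ⟨hy, hy'⟩ := quadraticChar_abs_le y
          have hxy : quadraticChar F x * quadraticChar F y ≤ 1 := by nlinarith
          have hq : (0 : ℤ) ≤ Fintype.card F := by positivity
          by_cases h : x ^ 2 = y ^ 2
          · rw [if_pos h]
            rcases sq_eq_sq_iff_eq_or_eq_neg.mp h with h | h
            · rw [if_pos h.symm]; split_ifs <;> nlinarith
            · rw [if_pos (show y = -x by rw [h, neg_neg])]; split_ifs <;> nlinarith
          · rw [if_neg h]; split_ifs <;> simp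
      _ = 2 * Fintype.card F := by simp [Finset.sum_add_distrib]; ring
  calc _ ≤ ∑ _x : F, 2 * (Fintype.card F : ℤ) := Finset.sum_le_sum fun x _ => h2 x
    _ = _ := by simp; ring

theorem sum_comp_pow_le {n : ℕ} (hn : 0 < n) (g : F → ℤ) (hg : ∀ x, 0 ≤ g x) :
    ∑ d : F, g (d ^ n) ≤ n * ∑ c, g c := by
  rw [← Finset.sum_fiberwise Finset.univ (fun d : F => d ^ n), Finset.mul_sum]
  refine Finset.sum_le_sum fun c _ => ?_
  rw [Finset.sum_congr rfl (g := fun _ => g c) (fun d hd => by rw [(Finset.mem_filter.mp hd).2]),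
    Finset.sum_const, nsmul_eq_mul]
  refine mul_le_mul_of_nonneg_right ?_ (hg c)
  have : (Finset.univ.filter fun d : F => d ^ n = c) ⊆ (nthRoots n c).toFinset := by
    intro d hd
    simpa [mem_nthRoots hn] using hd
  exact_mod_cast (Finset.card_le_card this).trans
    ((Multiset.toFinset_card_le _).trans (card_nthRoots n c))

/-- Scaling x by d² shows T(d⁴) = T(1), so the second moment contains T(1)² many times. Each fourth
power has at most 4 roots and the moment is at most 2q², whence 8 = 4 · 2. -/
theorem sq_sum_quadraticChar_cubic_le (hF : ringChar F ≠ 2) (hm1 : quadraticChar F (-1) = 1) :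
    ((Fintype.card F : ℤ) - 1) * (∑ x, quadraticChar F x * quadraticChar F (x ^ 2 - 1)) ^ 2 ≤
      8 * (Fintype.card F : ℤ) * Fintype.card F := by
  set T : F → ℤ := fun c => ∑ x, quadraticChar F x * quadraticChar F (x ^ 2 - c) with hT
  have h1 : ∀ d : F, d ≠ 0 → T (d ^ 4) = T 1 := by
    intro d hd
    simp only [hT]
    rw [← Equiv.sum_comp (Equiv.mulLeft₀ (d ^ 2) (pow_ne_zero 2 hd))]
    refine Finset.sum_congr rfl fun x _ => ?_
    have e : (d ^ 2 * x) ^ 2 - d ^ 4 = (d ^ 2) ^ 2 * (x ^ 2 - 1) := by ring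
    simp only [Equiv.mulLeft₀_apply]
    rw [e, map_mul, map_mul, quadraticChar_sq_one' hd, quadraticChar_sq_one' (pow_ne_zero 2 hd)]
    ring
  have h2 := sum_comp_pow_le (n := 4) (by norm_num) (fun c => T c ^ 2) (fun c => sq_nonneg _)
  have h3 := sum_sq_sum_quadraticChar_mul_sq_sub hF hm1
  have h4 : ((Fintype.card F : ℤ) - 1) * T 1 ^ 2 ≤ ∑ d : F, T (d ^ 4) ^ 2 := by
    rw [← Finset.sum_erase_add _ _ (Finset.mem_univ (0 : F)),
      Finset.sum_congr rfl (g := fun _ => T 1 ^ 2)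
        (fun d hd => by rw [h1 d (Finset.ne_of_mem_erase hd)]), Finset.sum_const,
      Finset.card_erase_of_mem (Finset.mem_univ _), Finset.card_univ, nsmul_eq_mul,
      Nat.cast_sub Fintype.card_pos, Nat.cast_one]
    have := sq_nonneg (T (0 ^ 4))
    linarith
  push_cast at h2
  linarith

/-- The reflection x ↦ 2 - x preserves {3, -1, 1} and exchanges -1/3 with 7/3, and the signs cancel.
The same square thus occurs twice in a second moment that is at most q²; this gains the factor 2. -/
theorem two_mul_sq_sum_quadraticChar_quartic_le (hF : ringChar F ≠ 2) (h3 : (3 : F) ≠ 0) :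
    2 * (∑ x, quadraticChar F ((x - 3) * (x + 1) * (x - 1)) * quadraticChar F (x + 1 / 3)) ^ 2 ≤
      (Fintype.card F : ℤ) * Fintype.card F := by
  have h2 : (2 : F) ≠ 0 := Ring.two_ne_zero hF
  set c : F → ℤ := fun x => quadraticChar F ((x - 3) * (x + 1) * (x - 1)) with hc
  set T : F → ℤ := fun a => ∑ x, c x * quadraticChar F (x - a) with hT
  have hsym : T (7 / 3) = T (-(1 / 3)) := by
    simp only [hT]
    rw [← Equiv.sum_comp (Equiv.subLeft (2 : F))]
    refine Finset.sum_congr rfl fun x _ => ?_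
    simp only [hc, Equiv.subLeft_apply]
    rw [← map_mul, ← map_mul]
    congr 1
    field_simp
    ring
  have hne : (7 / 3 : F) ≠ -(1 / 3) := by
    intro h
    field_simp at h
    have : (2 : F) ^ 3 = 0 := by linear_combination h
    exact h2 (pow_eq_zero_iff (by norm_num) |>.mp this)
  have hmom : ∑ a, T a ^ 2 = _ := sum_sq_sum_mul_quadraticChar hF c
  have hle : T (7 / 3) ^ 2 + T (-(1 / 3)) ^ 2 ≤ ∑ a, T a ^ 2 := by
    rw [← Finset.sum_pair hne (f := fun a => T a ^ 2)]
    exact Finset.sum_le_sum_of_subset_of_nonneg (Finset.subset_univ _) fun _ _ _ => sq_nonneg _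
  have hcs : ∑ x, c x ^ 2 ≤ (Fintype.card F : ℤ) := by
    calc _ ≤ ∑ _x : F, (1 : ℤ) := by
          refine Finset.sum_le_sum fun x _ => ?_
          obtain ⟨h, h'⟩ := quadraticChar_abs_le ((x - 3) * (x + 1) * (x - 1))
          simp only [hc]; nlinarith
      _ = _ := by simp
  have hfin : ∑ x, c x * quadraticChar F (x + 1 / 3) = T (-(1 / 3)) := by
    simp [hT]
  rw [hfin]
  have hq : (0 : ℤ) ≤ Fintype.card F := by positivity
  rw [hsym] at hle
  nlinarith [sq_nonneg (∑ x, c x)]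

end CharacterSums

/-! ### Two simultaneous nonsquares. -/

section NonsquarePair

/-- When -1 is a square and σ ≠ 0, the conditions on σ say that s = σ - 1 and t = -1/σ - 1 are
distinct and that s² - 4 and t² - 4 are both nonsquares. -/
theorem exists_nonsquare_pair_of_ringEquiv {E F : Type*} [Field E] [Field F] (e : E ≃+* F)
    (h : ∃ σ : E, ¬ IsSquare ((σ - 3) * (σ + 1)) ∧ ¬ IsSquare ((3 * σ + 1) * (σ - 1)) ∧
      σ ^ 2 ≠ -1) :
    ∃ σ : F, ¬ IsSquare ((σ - 3) * (σ + 1)) ∧ ¬ IsSquare ((3 * σ + 1) * (σ - 1)) ∧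
      σ ^ 2 ≠ -1 := by
  obtain ⟨σ, h1, h2, h3⟩ := h
  refine ⟨e σ, fun h => h1 ?_, fun h => h2 ?_, fun h => h3 ?_⟩
  · simpa [map_ofNat e.symm 3] using h.map e.symm
  · simpa [map_ofNat e.symm 3] using h.map e.symm
  · simpa using congrArg e.symm h

variable {F : Type*} [Field F] [Fintype F]

theorem ringChar_ne_two_of_odd_card (hodd : Odd (Fintype.card F)) : ringChar F ≠ 2 := by
  intro h
  have := FiniteField.even_card_of_char_two h
  rw [Nat.odd_iff] at hodd
  omega

theorem isSquare_neg_one_of_card (h4 : 4 ∣ Fintype.card F - 1) : ∃ i : F, i ^ 2 = -1 := by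
  have h : IsSquare (-1 : F) := by
    rw [FiniteField.isSquare_neg_one_iff]
    have := Fintype.card_pos (α := F)
    omega
  obtain ⟨i, hi⟩ := h
  exact ⟨i, by rw [hi]; ring⟩

-- With σ = x + 1 the two quantities are x² - 1 and x. If no σ worked, ∑ (1 - χ(x))(1 - χ(x² - 1)) =
-- q + 1 + S would be supported on the two x with σ² = -1, hence at most 4 + 4. The bound (q-1) S² ≤
-- 8q² excludes this from q = 20 on.
open Classical in
theorem exists_nonsquare_pair_of_char_three (hodd : Odd (Fintype.card F))
    (h4 : 4 ∣ Fintype.card F - 1) (h3 : (3 : F) = 0) (hq : 20 ≤ Fintype.card F) :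
    ∃ σ : F, ¬ IsSquare ((σ - 3) * (σ + 1)) ∧ ¬ IsSquare ((3 * σ + 1) * (σ - 1)) ∧
      σ ^ 2 ≠ -1 := by
  have hF := ringChar_ne_two_of_odd_card hodd
  obtain ⟨i, hi⟩ := isSquare_neg_one_of_card h4
  have hi0 : i ≠ 0 := by rintro rfl; norm_num at hi
  have hm1 : quadraticChar F (-1) = 1 := by rw [← hi, quadraticChar_sq_one' hi0]
  have key := sq_sum_quadraticChar_cubic_le hF hm1
  by_contra! hcon
  set S := ∑ x, quadraticChar F x * quadraticChar F (x ^ 2 - 1) with hS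
  have hsum : ∑ x : F, (1 - quadraticChar F x) * (1 - quadraticChar F (x ^ 2 - 1)) =
      Fintype.card F + 1 + S := by
    have h1 := quadraticChar_sum_zero hF
    have h2 := sum_quadraticChar_sub_mul_sub hF 1 (-1)
    rw [if_neg (fun h => Ring.neg_one_ne_one_of_char_ne_two hF h.symm)] at h2
    have h2' : ∑ x, quadraticChar F (x ^ 2 - 1) = -1 := by
      rw [← sub_eq_zero, sub_eq_add_neg] at *
      rw [← h2]
      simp_rw [← map_mul]
      ring_nf
    calc _ = ∑ x : F, (1 - quadraticChar F x - quadraticChar F (x ^ 2 - 1) +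
              quadraticChar F x * quadraticChar F (x ^ 2 - 1)) :=
            Finset.sum_congr rfl fun x _ => by ring
      _ = _ := by
        rw [Finset.sum_add_distrib, Finset.sum_sub_distrib, Finset.sum_sub_distrib, h1, h2', ← hS]
        simp
  have hbound : ∑ x : F, (1 - quadraticChar F x) * (1 - quadraticChar F (x ^ 2 - 1)) ≤ 8 := by
    calc _ ≤ ∑ x : F, ((if x = i - 1 then (4 : ℤ) else 0) + if x = -i - 1 then (4 : ℤ) else 0) := by
          refine Finset.sum_le_sum fun x _ => ?_
          have hpos : (0 : ℤ) ≤ (if x = i - 1 then (4 : ℤ) else 0) +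
            if x = -i - 1 then (4 : ℤ) else 0 := by positivity
          by_cases hx : IsSquare x
          · by_cases hx0 : x = 0
            · subst hx0
              simpa [hm1] using hpos
            · rw [(quadraticChar_one_iff_isSquare hx0).mpr hx]
              simpa using hpos
          by_cases hx' : IsSquare (x ^ 2 - 1)
          · by_cases hx0 : x ^ 2 - 1 = 0
            · rcases sq_eq_one_iff.mp (sub_eq_zero.mp hx0) with rfl | rfl
              · simpa using hpos
              · simpa [hm1] using hpos
            · rw [(quadraticChar_one_iff_isSquare hx0).mpr hx']
              simpa using hpos
          have hc := hcon (x + 1)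
            (by
              have : (x + 1 - 3) * (x + 1 + 1) = x ^ 2 - 1 := by
                linear_combination -h3
              rwa [this])
            (by
              have : (3 * (x + 1) + 1) * (x + 1 - 1) = x := by
                linear_combination (x + 1) * x * h3
              rwa [this])
          rw [quadraticChar_neg_one_iff_not_isSquare.mpr hx,
            quadraticChar_neg_one_iff_not_isSquare.mpr hx']
          rw [← hi] at hc
          rcases sq_eq_sq_iff_eq_or_eq_neg.mp hc with h | h
          · rw [if_pos (show x = i - 1 by linear_combination h)]
            split_ifs <;> norm_num
          · rw [if_pos (show x = -i - 1 by linear_combination h)]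
            split_ifs <;> norm_num
      _ = 8 := by rw [Finset.sum_add_distrib]; simp
  rw [hsum] at hbound
  have hq' : (20 : ℤ) ≤ Fintype.card F := by exact_mod_cast hq
  generalize (Fintype.card F : ℤ) = q at *
  have h5 : (q - 7) ^ 2 ≤ S ^ 2 := by nlinarith
  have h6 : (q - 1) * (q - 7) ^ 2 ≤ 8 * q * q := by nlinarith
  nlinarith [mul_nonneg (by linarith : (0 : ℤ) ≤ q - 20) (by linarith : (0 : ℤ) ≤ q - 1),
    mul_nonneg (by linarith : (0 : ℤ) ≤ q - 20) (sq_nonneg (q - 1))]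

-- The same count: the points ±i contribute at most 4 each and the zeros 3, -1/3 at most 2 each,
-- hence 12. At the zeros -1 and 1 the other quantity is 4 or -4, a nonzero square, so these
-- contribute nothing. Then q - 12 ≤ |S| ≤ q/√2, which fails from q = 41 on.
open Classical in
theorem exists_nonsquare_pair_of_large (hodd : Odd (Fintype.card F))
    (h4 : 4 ∣ Fintype.card F - 1) (h3 : (3 : F) ≠ 0) (hq : 41 ≤ Fintype.card F) :
    ∃ σ : F, ¬ IsSquare ((σ - 3) * (σ + 1)) ∧ ¬ IsSquare ((3 * σ + 1) * (σ - 1)) ∧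
      σ ^ 2 ≠ -1 := by
  have hF := ringChar_ne_two_of_odd_card hodd
  have h2 : (2 : F) ≠ 0 := Ring.two_ne_zero hF
  obtain ⟨i, hi⟩ := isSquare_neg_one_of_card h4
  have hi0 : i ≠ 0 := by rintro rfl; norm_num at hi
  have hm1 : quadraticChar F (-1) = 1 := by rw [← hi, quadraticChar_sq_one' hi0]
  have key := two_mul_sq_sum_quadraticChar_quartic_le hF h3
  by_contra! hcon
  set S := ∑ x, quadraticChar F ((x - 3) * (x + 1) * (x - 1)) * quadraticChar F (x + 1 / 3) with hS
  have hsum : ∑ x : F, (1 - quadraticChar F ((x - 3) * (x + 1))) *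
      (1 - quadraticChar F ((3 * x + 1) * (x - 1))) =
      Fintype.card F + 1 + quadraticChar F 3 + quadraticChar F 3 * S := by
    have hA := sum_quadraticChar_sub_mul_sub hF 3 (-1)
    rw [if_neg (fun h => h2 (pow_eq_zero_iff (n := 2) (by norm_num) |>.mp
      (by linear_combination h)))] at hA
    have hB := sum_quadraticChar_sub_mul_sub hF (-(1 / 3)) 1
    rw [if_neg (fun h => h2 (pow_eq_zero_iff (n := 2) (by norm_num) |>.mp
      (by field_simp at h; linear_combination -h)))] at hB
    have hA' : ∑ x, quadraticChar F ((x - 3) * (x + 1)) = -1 := by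
      rw [zero_sub] at hA
      rw [← hA]
      refine Finset.sum_congr rfl fun x _ => ?_
      rw [map_mul, sub_neg_eq_add]
    have hf : ∀ x : F, (3 * x + 1) * (x - 1) = 3 * ((x + 1 / 3) * (x - 1)) := by
      intro x; field_simp
    have hB' : ∑ x, quadraticChar F ((3 * x + 1) * (x - 1)) = -quadraticChar F 3 := by
      rw [zero_sub] at hB
      rw [← mul_neg_one, ← hB, Finset.mul_sum]
      refine Finset.sum_congr rfl fun x _ => ?_
      rw [hf, map_mul, map_mul, sub_neg_eq_add]
    have hC : ∑ x, quadraticChar F ((x - 3) * (x + 1)) * quadraticChar F ((3 * x + 1) * (x - 1)) =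
        quadraticChar F 3 * S := by
      rw [hS, Finset.mul_sum]
      refine Finset.sum_congr rfl fun x _ => ?_
      rw [hf]
      simp only [map_mul]
      ring
    calc _ = ∑ x : F, (1 - quadraticChar F ((x - 3) * (x + 1))
              - quadraticChar F ((3 * x + 1) * (x - 1)) +
              quadraticChar F ((x - 3) * (x + 1)) * quadraticChar F ((3 * x + 1) * (x - 1))) :=
            Finset.sum_congr rfl fun x _ => by ring
      _ = _ := by
        rw [Finset.sum_add_distrib, Finset.sum_sub_distrib, Finset.sum_sub_distrib, hA', hB', hC]
        simp
  have hbound : ∑ x : F, (1 - quadraticChar F ((x - 3) * (x + 1))) *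
      (1 - quadraticChar F ((3 * x + 1) * (x - 1))) ≤ 12 := by
    calc _ ≤ ∑ x : F, ((if x = i then (4 : ℤ) else 0) + (if x = -i then (4 : ℤ) else 0) +
            ((if x = 3 then (2 : ℤ) else 0) + if x = -(1 / 3) then (2 : ℤ) else 0)) := by
          refine Finset.sum_le_sum fun x _ => ?_
          have hpos1 : (0 : ℤ) ≤ (if x = i then (4 : ℤ) else 0) + (if x = -i then (4 : ℤ) else 0) := by
            positivity
          have hpos2 : (0 : ℤ) ≤ (if x = 3 then (2 : ℤ) else 0) +
            (if x = -(1 / 3) then (2 : ℤ) else 0) := by positivity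
          have hpos := add_nonneg hpos1 hpos2
          by_cases hx : IsSquare ((x - 3) * (x + 1))
          · by_cases hx0 : (x - 3) * (x + 1) = 0
            · rcases mul_eq_zero.mp hx0 with h | h
              · rw [if_pos (show x = 3 by linear_combination h)] at hpos2 ⊢
                rw [hx0, quadraticChar_zero]
                obtain ⟨h5, h6⟩ := quadraticChar_abs_le ((3 * x + 1) * (x - 1))
                have : (0 : ℤ) ≤ if x = -(1 / 3) then (2 : ℤ) else 0 := by positivity
                linarith
              · have e : (3 * x + 1) * (x - 1) = 2 ^ 2 := by linear_combination (3 * x - 5) * h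
                rw [e, quadraticChar_sq_one' h2]
                simpa using hpos
            · rw [(quadraticChar_one_iff_isSquare hx0).mpr hx]
              simpa using hpos
          by_cases hx' : IsSquare ((3 * x + 1) * (x - 1))
          · by_cases hx0 : (3 * x + 1) * (x - 1) = 0
            · rcases mul_eq_zero.mp hx0 with h | h
              · have hx3 : x = -(1 / 3) := by field_simp; linear_combination h
                rw [if_pos hx3] at hpos2 ⊢
                rw [hx0, quadraticChar_zero]
                obtain ⟨h5, h6⟩ := quadraticChar_abs_le ((x - 3) * (x + 1))
                have : (0 : ℤ) ≤ if x = 3 then (2 : ℤ) else 0 := by positivity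
                linarith
              · have e : (x - 3) * (x + 1) = -1 * 2 ^ 2 := by linear_combination (x - 1) * h
                rw [e, map_mul, hm1, quadraticChar_sq_one' h2]
                simpa using hpos
            · rw [(quadraticChar_one_iff_isSquare hx0).mpr hx']
              simpa using hpos
          have hc := hcon x hx hx'
          rw [quadraticChar_neg_one_iff_not_isSquare.mpr hx,
            quadraticChar_neg_one_iff_not_isSquare.mpr hx']
          rw [← hi] at hc
          have hpos3 : (0 : ℤ) ≤ if x = i then (4 : ℤ) else 0 := by positivity
          have hpos4 : (0 : ℤ) ≤ if x = -i then (4 : ℤ) else 0 := by positivity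
          rcases sq_eq_sq_iff_eq_or_eq_neg.mp hc with h | h
          · rw [if_pos h]
            linarith
          · rw [if_pos h]
            linarith
      _ = 12 := by simp only [Finset.sum_add_distrib]; simp
  rw [hsum] at hbound
  have hq' : (41 : ℤ) ≤ Fintype.card F := by exact_mod_cast hq
  generalize (Fintype.card F : ℤ) = q at *
  have h5 : (q - 12) ^ 2 ≤ S ^ 2 := by
    rcases quadraticChar_dichotomy h3 with h | h <;> rw [h] at hbound <;> nlinarith
  nlinarith

theorem exists_nonsquare_pair_of_prime {p : ℕ} (hp : p.Prime) (hcard : Fintype.card F = p)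
    (h : ∃ σ : ZMod p, ¬ IsSquare ((σ - 3) * (σ + 1)) ∧ ¬ IsSquare ((3 * σ + 1) * (σ - 1)) ∧
      σ ^ 2 ≠ -1) :
    ∃ σ : F, ¬ IsSquare ((σ - 3) * (σ + 1)) ∧ ¬ IsSquare ((3 * σ + 1) * (σ - 1)) ∧
      σ ^ 2 ≠ -1 := by
  have := Fact.mk hp
  exact exists_nonsquare_pair_of_ringEquiv (ZMod.ringEquivOfPrime F hp hcard) h

/-- Here σ = √2 works, by Euler's criterion with exponent 12; all powers are reduced by r² = 2 and 5
= 0. -/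
theorem exists_nonsquare_pair_of_card_eq_twentyfive (hcard : Fintype.card F = 25) :
    ∃ σ : F, ¬ IsSquare ((σ - 3) * (σ + 1)) ∧ ¬ IsSquare ((3 * σ + 1) * (σ - 1)) ∧
      σ ^ 2 ≠ -1 := by
  have h5 : (5 : F) = 0 := by
    have : ((25 : ℕ) : F) = 0 := by rw [← hcard]; exact Nat.cast_card_eq_zero F
    push_cast at this
    exact pow_eq_zero_iff (n := 2) (by norm_num) |>.mp (by linear_combination this)
  have hF : ringChar F ≠ 2 := ringChar_ne_two_of_odd_card (by rw [hcard]; decide)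
  have h2 : (2 : F) ≠ 0 := Ring.two_ne_zero hF
  have h2' : IsSquare (2 : F) := by
    rw [FiniteField.isSquare_iff hF h2, hcard]
    norm_num
    linear_combination 819 * h5
  obtain ⟨r, hr⟩ := h2'
  have hns : ∀ x : F, x ≠ 0 → x ^ 12 = -1 → ¬ IsSquare x := by
    intro x hx0 hx h
    rw [FiniteField.isSquare_iff hF hx0, hcard] at h
    norm_num at h
    exact h2 (by linear_combination hx - h)
  have hB : (3 * r + 1) * (r - 1) = 3 * r := by linear_combination (-3) * hr + (1 - r) * h5
  have hA : (r - 3) * (r + 1) = 4 + 3 * r := by linear_combination -hr - (1 + r) * h5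
  have hB12 : ((3 * r + 1) * (r - 1)) ^ 12 = -1 := by
    rw [hB]
    have h : (3 * r) ^ 4 = -1 := by
      linear_combination (-81) * (r * r + 2) * hr + 65 * h5
    linear_combination ((3 * r) ^ 8 - (3 * r) ^ 4 + 1) * h
  have hA12 : ((r - 3) * (r + 1)) ^ 12 = -1 := by
    rw [hA]
    have e2 : (4 + 3 * r) ^ 2 = 4 + 4 * r := by linear_combination (-9) * hr + (6 + 4 * r) * h5
    have e4 : (4 + 4 * r) ^ 2 = 3 + 2 * r := by linear_combination (-16) * hr + (9 + 6 * r) * h5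
    have e6 : (3 + 2 * r) * (4 + 4 * r) = 3 := by linear_combination (-8) * hr + (5 + 4 * r) * h5
    have e : (4 + 3 * r) ^ 6 = 3 := by
      calc (4 + 3 * r) ^ 6 = (((4 + 3 * r) ^ 2) ^ 2) * (4 + 3 * r) ^ 2 := by ring
        _ = 3 := by rw [e2, e4, e6]
    linear_combination ((4 + 3 * r) ^ 6 + 3) * e + 2 * h5
  have hm1 : (-1 : F) ≠ 0 := by simp
  refine ⟨r, hns _ (fun h => ?_) hA12, hns _ (fun h => ?_) hB12, fun h => ?_⟩
  · rw [h] at hA12; norm_num at hA12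
  · rw [h] at hB12; norm_num at hB12
  · exact h2 (by linear_combination h5 - h - hr)

/-- In characteristic 3 the only order below 20 is 9, where 5 ∣ q + 1. Otherwise the congruences
leave just 13, 17, 25 and 37 below 41. -/
theorem exists_nonsquare_pair (h4 : 4 ∣ Fintype.card F - 1) (hq : 9 ≤ Fintype.card F)
    (h5 : ¬ 5 ∣ Fintype.card F + 1) :
    ∃ σ : F, ¬ IsSquare ((σ - 3) * (σ + 1)) ∧ ¬ IsSquare ((3 * σ + 1) * (σ - 1)) ∧
      σ ^ 2 ≠ -1 := by
  have hodd : Odd (Fintype.card F) := by rw [Nat.odd_iff]; omega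
  by_cases h3 : (3 : F) = 0
  · refine exists_nonsquare_pair_of_char_three hodd h4 h3 ?_
    by_contra hlt
    have h3' : 3 ∣ Fintype.card F := by
      obtain ⟨p, _, n, hp, hn⟩ := FiniteField.card' F
      have h := (CharP.cast_eq_zero_iff F p 3).mp (by exact_mod_cast h3)
      rw [hn, (Nat.prime_dvd_prime_iff_eq hp Nat.prime_three).mp h]
      exact dvd_pow_self 3 n.ne_zero
    omega
  · by_cases hq' : 41 ≤ Fintype.card F
    · exact exists_nonsquare_pair_of_large hodd h4 h3 hq'
    have h3' : ¬ 3 ∣ Fintype.card F := by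
      intro h
      obtain ⟨p, _, n, hp, hn⟩ := FiniteField.card' F
      rw [hn] at h
      have h := (Nat.prime_dvd_prime_iff_eq Nat.prime_three hp).mp (Nat.prime_three.dvd_of_dvd_pow h)
      subst h
      exact h3 (by exact_mod_cast CharP.cast_eq_zero F 3)
    have : Fintype.card F = 13 ∨ Fintype.card F = 17 ∨ Fintype.card F = 25 ∨
        Fintype.card F = 37 := by
      generalize Fintype.card F = n at *
      clear hodd
      interval_cases n <;> omega
    rcases this with h | h | h | h
    · exact exists_nonsquare_pair_of_prime (by norm_num) h (by decide)
    · exact exists_nonsquare_pair_of_prime (by norm_num) h (by decide)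
    · exact exists_nonsquare_pair_of_card_eq_twentyfive h
    · exact exists_nonsquare_pair_of_prime (by norm_num) h ⟨4, by decide⟩

end NonsquarePair

/-! ### Frobenius on the quadratic extension, and five special roots of unity. -/

section QuadraticExtension

variable {F K : Type*} [Field F] [Fintype F] [Field K] [Algebra F K] {q : ℕ}

theorem finite_of_finrank_eq_two (hK : Module.finrank F K = 2) : Finite K := by
  have : Module.Finite F K := Module.finite_of_finrank_pos (by rw [hK]; norm_num)
  exact Module.finite_of_finite F

theorem algebraMap_trace_eq_add_pow (hq : Fintype.card F = q) (hK : Module.finrank F K = 2)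
    (x : K) : algebraMap F K (Algebra.trace F K x) = x + x ^ q := by
  have := finite_of_finrank_eq_two hK
  rw [FiniteField.algebraMap_trace_eq_sum_pow, hK, Nat.card_eq_fintype_card, hq]
  simp [Finset.sum_range_succ]

theorem pow_card_pow_card_eq_self (hq : Fintype.card F = q) (hK : Module.finrank F K = 2)
    (x : K) : (x ^ q) ^ q = x := by
  have := finite_of_finrank_eq_two hK
  have := Fintype.ofFinite K
  have h := FiniteField.pow_card x
  rw [Module.card_eq_pow_finrank (K := F) (V := K), hK, hq, sq, pow_mul] at h
  exact h

theorem exists_algebraMap_eq_of_pow_card_eq_self (hq : Fintype.card F = q)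
    (hK : Module.finrank F K = 2) (h2 : (2 : F) ≠ 0) {x : K} (hx : x ^ q = x) :
    ∃ a : F, algebraMap F K a = x := by
  refine ⟨Algebra.trace F K x / 2, ?_⟩
  have h2' : (2 : K) ≠ 0 := by
    simpa [map_ofNat (algebraMap F K) 2] using (_root_.map_ne_zero (algebraMap F K)).mpr h2
  rw [map_div₀, algebraMap_trace_eq_add_pow hq hK, hx, map_ofNat]
  field_simp
  ring

theorem add_pow_card_field (hq : Fintype.card F = q) (x y : K) :
    (x + y) ^ q = x ^ q + y ^ q := by
  have := map_add (FiniteField.frobeniusAlgHom F K) x y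
  simpa [FiniteField.coe_frobeniusAlgHom, hq] using this

theorem sum_pow_card_field (hq : Fintype.card F = q) {ι : Type*} (s : Finset ι) (f : ι → K) :
    (∑ i ∈ s, f i) ^ q = ∑ i ∈ s, f i ^ q := by
  have := map_sum (FiniteField.frobeniusAlgHom F K) f s
  rwa [FiniteField.coe_frobeniusAlgHom, hq] at this

theorem algebraMap_pow_card_field (hq : Fintype.card F = q) (a : F) :
    (algebraMap F K a) ^ q = algebraMap F K a := by
  rw [← map_pow, ← hq, FiniteField.pow_card]

theorem pow_eq_inv_of_pow_add_one {u : K} (hu : u ^ (q + 1) = 1) : u ^ q = u⁻¹ := by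
  rw [pow_succ] at hu
  exact eq_inv_of_mul_eq_one_left hu

theorem ne_zero_of_pow_add_one {u : K} (hu : u ^ (q + 1) = 1) : u ≠ 0 := by
  rintro rfl
  simp at hu

theorem exists_sq_eq_algebraMap (hq : Fintype.card F = q) (hodd : Odd q)
    (hK : Module.finrank F K = 2) (x : F) : ∃ r : K, r ^ 2 = algebraMap F K x := by
  have := finite_of_finrank_eq_two hK
  have := Fintype.ofFinite K
  by_cases hx : x = 0
  · exact ⟨0, by simp [hx]⟩
  have hcard : Fintype.card K = q ^ 2 := by
    rw [Module.card_eq_pow_finrank (K := F) (V := K), hK, hq]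
  have hcK : ringChar K ≠ 2 := ringChar_ne_two_of_odd_card (by rw [hcard]; exact hodd.pow)
  have h : IsSquare (algebraMap F K x) := by
    rw [FiniteField.isSquare_iff hcK ((_root_.map_ne_zero _).mpr hx), hcard]
    obtain ⟨m, hm⟩ := hodd
    -- The truncated quotient is (q² - 1)/2, a multiple of q - 1, so Euler's criterion holds for
    -- every nonzero element of F.
    have e : q ^ 2 / 2 = (q - 1) * ((q + 1) / 2) := by
      subst hm
      have e1 : (2 * m + 1) ^ 2 = 2 * (2 * m * (m + 1)) + 1 := by ring
      rw [e1, show 2 * m + 1 - 1 = 2 * m by omega, show (2 * m + 1 + 1) / 2 = m + 1 by omega]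
      omega
    rw [e, pow_mul, ← map_pow, ← hq, FiniteField.pow_card_sub_one_eq_one x hx]
    simp
  obtain ⟨r, hr⟩ := h
  exact ⟨r, by rw [hr, sq]⟩

/-- If `s² - 4` is a nonsquare of `F`, then `X² - s X + 1` has two distinct roots, which are
`(q + 1)`-th roots of unity. -/
theorem exists_unit_root_of_not_isSquare (hq : Fintype.card F = q) (hodd : Odd q)
    (hK : Module.finrank F K = 2) {s : F} (hs : ¬ IsSquare (s ^ 2 - 4)) :
    ∃ u : K, u ^ (q + 1) = 1 ∧ u ≠ u⁻¹ ∧ u + u⁻¹ = algebraMap F K s := by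
  have h2F : (2 : F) ≠ 0 := Ring.two_ne_zero (ringChar_ne_two_of_odd_card (by rwa [hq]))
  have h2 : (2 : K) ≠ 0 := by
    simpa [map_ofNat (algebraMap F K) 2] using (_root_.map_ne_zero (algebraMap F K)).mpr h2F
  obtain ⟨r, hr⟩ := exists_sq_eq_algebraMap (K := K) hq hodd hK (s ^ 2 - 4)
  have hr' : r ^ 2 = algebraMap F K s ^ 2 - 4 := by rw [hr]; simp [map_ofNat (algebraMap F K) 4]
  set S := algebraMap F K s with hS
  have hr0 : r ≠ 0 := by
    rintro rfl
    refine hs ⟨0, (algebraMap F K).injective ?_⟩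
    rw [← hr]; simp
  -- If Frobenius fixed r, then s² - 4 would be a square in F. So it negates r and swaps the roots
  -- (s ± r)/2, whose product is 1.
  have hrq : r ^ q = -r := by
    have h : (r ^ q) ^ 2 = r ^ 2 := by
      rw [← pow_mul, mul_comm, pow_mul, hr, algebraMap_pow_card_field hq]
    rcases sq_eq_sq_iff_eq_or_eq_neg.mp h with h | h
    · obtain ⟨a, ha⟩ := exists_algebraMap_eq_of_pow_card_eq_self hq hK h2F h
      refine absurd ⟨a, (algebraMap F K).injective ?_⟩ hs
      rw [← hr, ← ha, ← sq, map_pow]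
    · exact h
  have h2q : ((2 : K)⁻¹) ^ q = 2⁻¹ := by
    have := algebraMap_pow_card_field (K := K) hq ((2 : F)⁻¹)
    simpa [map_ofNat (algebraMap F K) 2] using this
  have hprod : (S + r) * 2⁻¹ * ((S - r) * 2⁻¹) = 1 := by
    field_simp
    linear_combination -hr'
  have hinv : ((S + r) * 2⁻¹)⁻¹ = (S - r) * 2⁻¹ := inv_eq_of_mul_eq_one_right hprod
  refine ⟨(S + r) * 2⁻¹, ?_, ?_, ?_⟩
  · rw [pow_succ, mul_pow, add_pow_card_field hq, algebraMap_pow_card_field hq, hrq, h2q,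
      ← sub_eq_add_neg, mul_comm, hprod]
  · rw [hinv]
    intro h
    apply hr0
    have : 2 * r = 0 := by
      field_simp at h
      linear_combination h
    exact (mul_eq_zero.mp this).resolve_left h2
  · rw [hinv]
    field_simp
    ring

/-- The absence of u³ and u² is what matters. In (X-1)(X²-sX+1)(X²-tX+1) the coefficients of X³ and
X² are ±(s + t + st + 2), and s + 1 = σ, t + 1 = -1/σ makes them vanish. -/
theorem exists_five_unit_roots (hq : Fintype.card F = q) (h9 : 9 ≤ q)
    (hK : Module.finrank F K = 2) {β : K} (hβ : IsPrimitiveRoot β (q + 1)) (h4 : 4 ∣ q - 1) :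
    ∃ S : Finset K, S.card = 5 ∧ (∀ u ∈ S, u ^ (q + 1) = 1) ∧
      ∃ a b c : K, ∀ u ∈ S, u ^ 5 = a * u ^ 4 + b * u + c := by
  classical
  have hodd : Odd q := by rw [Nat.odd_iff]; omega
  by_cases h5 : 5 ∣ q + 1
  · obtain ⟨m, hm⟩ := h5
    have hp : IsPrimitiveRoot (β ^ m) 5 := hβ.pow (by omega) (by rw [hm, mul_comm])
    refine ⟨nthRootsFinset 5 (1 : K), hp.card_nthRootsFinset, fun u hu => ?_, 0, 0, 1,
      fun u hu => ?_⟩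
    · rw [mem_nthRootsFinset (by norm_num)] at hu
      rw [hm, pow_mul, hu, one_pow]
    · rw [mem_nthRootsFinset (by norm_num)] at hu
      rw [hu]; ring
  · obtain ⟨σ, hA, hB, hσ⟩ := exists_nonsquare_pair (F := F) (by rwa [hq]) (by rwa [hq])
      (by rwa [hq])
    obtain ⟨i, hi⟩ := isSquare_neg_one_of_card (F := F) (by rwa [hq])
    have h2F : (2 : F) ≠ 0 := Ring.two_ne_zero (ringChar_ne_two_of_odd_card (by rwa [hq]))
    have hσ0 : σ ≠ 0 := by
      rintro rfl
      exact hB ⟨i, by linear_combination -hi⟩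
    have hA' : ¬ IsSquare ((σ - 1) ^ 2 - 4) := by
      rwa [show (σ - 1) ^ 2 - 4 = (σ - 3) * (σ + 1) by ring]
    -- Here t² - 4 = -(3σ+1)(σ-1)/σ², and -1 = i².
    have hB' : ¬ IsSquare ((-1 / σ - 1) ^ 2 - 4) := by
      rintro ⟨r, hr⟩
      refine hB ⟨i * σ * r, ?_⟩
      have : i * σ * r * (i * σ * r) = -σ ^ 2 * ((-1 / σ - 1) ^ 2 - 4) := by
        rw [hr]; linear_combination (σ ^ 2 * r ^ 2) * hi
      rw [this]
      field_simp
      ring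
    obtain ⟨x, hx1, hx2, hx3⟩ := exists_unit_root_of_not_isSquare (K := K) hq hodd hK hA'
    obtain ⟨y, hy1, hy2, hy3⟩ := exists_unit_root_of_not_isSquare (K := K) hq hodd hK hB'
    have hx0 := ne_zero_of_pow_add_one hx1
    have hy0 := ne_zero_of_pow_add_one hy1
    have hst : algebraMap F K (σ - 1) ≠ algebraMap F K (-1 / σ - 1) := by
      intro h
      have := (algebraMap F K).injective h
      field_simp at this
      exact hσ (by linear_combination this)
    have hrel : algebraMap F K (σ - 1) + algebraMap F K (-1 / σ - 1) +
        algebraMap F K (σ - 1) * algebraMap F K (-1 / σ - 1) + 2 = 0 := by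
      have : (σ - 1) + (-1 / σ - 1) + (σ - 1) * (-1 / σ - 1) + 2 = 0 := by field_simp; ring
      simpa [map_ofNat (algebraMap F K) 2] using congrArg (algebraMap F K) this
    set s := algebraMap F K (σ - 1) with hs
    set t := algebraMap F K (-1 / σ - 1) with ht
    have hx1' : x ≠ 1 := by rintro rfl; simp at hx2
    have hy1' : y ≠ 1 := by rintro rfl; simp at hy2
    have hxy : x ≠ y := by rintro rfl; exact hst (hx3.symm.trans hy3)
    have hxy' : x ≠ y⁻¹ := by
      rintro rfl; apply hst; rw [← hx3, ← hy3, inv_inv, add_comm]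
    have hxi : x⁻¹ ≠ y⁻¹ := fun h => hxy (inv_injective h)
    have hxi' : x⁻¹ ≠ y := fun h => hxy' (by rw [← h, inv_inv])
    have hx1i : x⁻¹ ≠ 1 := by simpa using hx1'
    have hy1i : y⁻¹ ≠ 1 := by simpa using hy1'
    refine ⟨{1, x, x⁻¹, y, y⁻¹}, ?_, ?_, 1 + s + t, -(1 + s + t), 1, ?_⟩
    · simp [Finset.card_insert_of_notMem, hx2, hy2, hxy, hxy', hxi', hxi, hx1'.symm,
        hy1'.symm, Ne.symm hx1i, Ne.symm hy1i]
    · intro u hu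
      simp only [Finset.mem_insert, Finset.mem_singleton] at hu
      rcases hu with rfl | rfl | rfl | rfl | rfl <;> simp [hx1, hy1]
    · intro u hu
      have hfac : (u - 1) * (u ^ 2 - s * u + 1) * (u ^ 2 - t * u + 1) = 0 := by
        simp only [Finset.mem_insert, Finset.mem_singleton] at hu
        rcases hu with rfl | rfl | rfl | rfl | rfl
        · ring
        · rw [← hx3]; field_simp; ring
        · rw [← hx3]; field_simp; ring
        · rw [← hy3]; field_simp; ring
        · rw [← hy3]; field_simp; ring
      linear_combination hfac - (u ^ 3 - u ^ 2) * hrel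

end QuadraticExtension

/-! ### Small weights in the BCH code. -/

section BCHWeights

variable {F K : Type*} [Field F] [Field K] [Algebra F K] {q : ℕ}

theorem aeval_wordPoly {n : ℕ} (c : Fin n → F) (x : K) :
    aeval x (wordPoly c) = ∑ j, algebraMap F K (c j) * x ^ (j : ℕ) := by
  simp [wordPoly]

theorem mem_cyclicCode_iff_of_dvd {n : ℕ} {g : F[X]} (c : Fin n → F) :
    c ∈ cyclicCode n g ↔ ∃ a b : F[X], wordPoly c = g * a + (X ^ n - 1) * b := by
  change Ideal.Quotient.mk (Ideal.span {(X ^ n - 1 : F[X])}) (wordPoly c) ∈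
    Ideal.span {Ideal.Quotient.mk (Ideal.span {(X ^ n - 1 : F[X])}) g} ↔ _
  rw [Ideal.mem_span_singleton']
  constructor
  · rintro ⟨a, ha⟩
    obtain ⟨a, rfl⟩ := Ideal.Quotient.mk_surjective a
    rw [← map_mul, eq_comm, Ideal.Quotient.eq, Ideal.mem_span_singleton'] at ha
    obtain ⟨b, hb⟩ := ha
    exact ⟨a, b, by linear_combination -hb⟩
  · rintro ⟨a, b, h⟩
    refine ⟨Ideal.Quotient.mk _ a, ?_⟩
    rw [← map_mul, eq_comm, Ideal.Quotient.eq, Ideal.mem_span_singleton']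
    exact ⟨b, by rw [h]; ring⟩

/-- If divisibility by `g` means vanishing at certain `n`-th roots of unity, then so does membership
in the cyclic code generated by `g`. -/
theorem mem_cyclicCode_iff_forall_sum {n : ℕ} {g : F[X]} {β : K} (hβ : β ^ n = 1) (I : Finset ℕ)
    (hg : ∀ p : F[X], g ∣ p ↔ ∀ i ∈ I, aeval (β ^ i) p = 0) (c : Fin n → F) :
    c ∈ cyclicCode n g ↔ ∀ i ∈ I, ∑ j : Fin n, algebraMap F K (c j) * (β ^ (j : ℕ)) ^ i = 0 := by
  have e : ∀ i : ℕ, ∑ j : Fin n, algebraMap F K (c j) * (β ^ (j : ℕ)) ^ i =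
      aeval (β ^ i) (wordPoly c) := by
    intro i
    rw [aeval_wordPoly]
    refine Finset.sum_congr rfl fun j _ => ?_
    rw [← pow_mul, ← pow_mul, mul_comm i]
  simp_rw [e]
  rw [mem_cyclicCode_iff_of_dvd]
  constructor
  · rintro ⟨a, b, h⟩ i hi
    have hgi := (hg g).mp dvd_rfl i hi
    have : (β ^ i) ^ n = 1 := by rw [← pow_mul, mul_comm, pow_mul, hβ, one_pow]
    simp [h, hgi, this]
  · intro h
    obtain ⟨a, ha⟩ := (hg _).mpr h
    exact ⟨a, 0, by rw [ha]; ring⟩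

theorem mem_narrowSenseBCHCode_iff {n : ℕ} {β : K} (hβ : β ^ n = 1) (δ : ℕ) (c : Fin n → F) :
    c ∈ narrowSenseBCHCode F n β δ ↔
      ∀ i ∈ Finset.Icc 1 (δ - 1), ∑ j : Fin n, algebraMap F K (c j) * (β ^ (j : ℕ)) ^ i = 0 := by
  classical
  unfold narrowSenseBCHCode
  refine mem_cyclicCode_iff_forall_sum hβ _ (fun p => ?_) c
  rw [Finset.lcm_dvd_iff]
  exact forall₂_congr fun i _ => minpoly.dvd_iff

theorem mem_bch_four_iff {n : ℕ} {β : K} (hβ : β ^ n = 1) (c : Fin n → F) :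
    c ∈ narrowSenseBCHCode F n β 4 ↔
      ∀ i, 1 ≤ i → i ≤ 3 → ∑ j : Fin n, algebraMap F K (c j) * (β ^ (j : ℕ)) ^ i = 0 := by
  rw [mem_narrowSenseBCHCode_iff hβ]
  simp only [Finset.mem_Icc, and_imp]

theorem root_pow_card_add_one {β : K} (hβ : IsPrimitiveRoot β (q + 1)) (j : ℕ) :
    (β ^ j) ^ (q + 1) = 1 := by
  rw [← pow_mul, mul_comm, pow_mul, hβ.pow_eq_one, one_pow]

theorem root_injective {β : K} (hβ : IsPrimitiveRoot β (q + 1)) :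
    Function.Injective fun j : Fin (q + 1) => β ^ (j : ℕ) :=
  fun i j h => Fin.ext (hβ.pow_inj i.2 j.2 h)

/-- Frobenius fixes F and inverts U, so a vanishing sum at i gives one at -i. -/
theorem sum_mul_pow_pow_card [Fintype F] (hq : Fintype.card F = q) {β : K} (hβ : IsPrimitiveRoot β (q + 1))
    (c : Fin (q + 1) → F) (i : ℕ) :
    (∑ j : Fin (q + 1), algebraMap F K (c j) * (β ^ (j : ℕ)) ^ i) ^ q =
      ∑ j : Fin (q + 1), algebraMap F K (c j) * ((β ^ (j : ℕ)) ^ i)⁻¹ := by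
  rw [sum_pow_card_field hq]
  refine Finset.sum_congr rfl fun j _ => ?_
  rw [mul_pow, algebraMap_pow_card_field hq, ← pow_mul, mul_comm i, pow_mul,
    pow_eq_inv_of_pow_add_one (root_pow_card_add_one hβ _), inv_pow]

variable [Fintype F]

/-- The functional attached to a word of the BCH code only sees the coefficient of `X³`. -/
theorem bch_sum_mul_eval (hq : Fintype.card F = q) {β : K} (hβ : IsPrimitiveRoot β (q + 1))
    {c : Fin (q + 1) → F} (hc : c ∈ narrowSenseBCHCode F (q + 1) β 4) {P : K[X]}
    (hP : P.natDegree < 7) :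
    ∑ j : Fin (q + 1), algebraMap F K (c j) * ((β ^ (j : ℕ)) ^ 3)⁻¹ * P.eval (β ^ (j : ℕ)) =
      P.coeff 3 * ∑ j : Fin (q + 1), algebraMap F K (c j) := by
  rw [mem_bch_four_iff hβ.pow_eq_one] at hc
  have hinv : ∀ i, 1 ≤ i → i ≤ 3 →
      ∑ j : Fin (q + 1), algebraMap F K (c j) * ((β ^ (j : ℕ)) ^ i)⁻¹ = 0 := by
    intro i h1 h3
    rw [← sum_mul_pow_pow_card hq hβ, hc i h1 h3]
    exact zero_pow (by rw [← hq]; exact Fintype.card_ne_zero)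
  have hmon : ∀ k < 7, ∑ j : Fin (q + 1), algebraMap F K (c j) * ((β ^ (j : ℕ)) ^ 3)⁻¹ *
      (β ^ (j : ℕ)) ^ k = if k = 3 then ∑ j : Fin (q + 1), algebraMap F K (c j) else 0 := by
    intro k hk
    rcases lt_trichotomy k 3 with h | h | h
    · rw [if_neg h.ne, ← hinv (3 - k) (by omega) (by omega)]
      refine Finset.sum_congr rfl fun j _ => ?_
      have h0 := ne_zero_of_pow_add_one (root_pow_card_add_one hβ (j : ℕ))
      have : (β ^ (j : ℕ)) ^ 3 = (β ^ (j : ℕ)) ^ (3 - k) * (β ^ (j : ℕ)) ^ k := by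
        rw [← pow_add]; congr 1; omega
      rw [this]
      field_simp
    · rw [if_pos h, h]
      refine Finset.sum_congr rfl fun j _ => ?_
      have h0 := ne_zero_of_pow_add_one (root_pow_card_add_one hβ (j : ℕ))
      field_simp
    · rw [if_neg h.ne', ← hc (k - 3) (by omega) (by omega)]
      refine Finset.sum_congr rfl fun j _ => ?_
      have h0 := ne_zero_of_pow_add_one (root_pow_card_add_one hβ (j : ℕ))
      have : (β ^ (j : ℕ)) ^ k = (β ^ (j : ℕ)) ^ 3 * (β ^ (j : ℕ)) ^ (k - 3) := by
        rw [← pow_add]; congr 1; omega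
      rw [this]
      field_simp
  simp_rw [eval_eq_sum_range' hP, Finset.mul_sum]
  rw [Finset.sum_comm]
  calc _ = ∑ k ∈ Finset.range 7, P.coeff k *
        if k = 3 then ∑ j : Fin (q + 1), algebraMap F K (c j) else 0 := by
        refine Finset.sum_congr rfl fun k hk => ?_
        rw [← hmon k (Finset.mem_range.mp hk), Finset.mul_sum]
        exact Finset.sum_congr rfl fun j _ => by ring
    _ = _ := by
      simp [Finset.mul_sum]

-- Let P vanish on the support except at one point. The functional of `bch_sum_mul_eval` has then a
-- single nonzero term, so both the X³-coefficient and ∑ c are nonzero. Weight at most 7 keeps deg P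
-- at most 6.
open Classical in
theorem bch_coeff_three_mul_sum_ne_zero (hq : Fintype.card F = q) {β : K}
    (hβ : IsPrimitiveRoot β (q + 1)) {c : Fin (q + 1) → F}
    (hc : c ∈ narrowSenseBCHCode F (q + 1) β 4) (hc0 : c ≠ 0) (hw : hammingNorm c ≤ 7) :
    4 ≤ hammingNorm c ∧ ∑ j, c j ≠ 0 := by
  obtain ⟨j₀, hj₀⟩ := Function.ne_iff.mp hc0
  set T : Finset (Fin (q + 1)) := Finset.univ.filter fun j => c j ≠ 0 with hT
  have hcard : hammingNorm c = T.card := by simp [hammingNorm, hT]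
  have hj₀T : j₀ ∈ T := by simpa [hT] using hj₀
  set P : K[X] := ∏ j ∈ T.erase j₀, (X - C (β ^ (j : ℕ))) with hP
  have hdeg : P.natDegree = T.card - 1 := by
    rw [hP, natDegree_finsetProd_X_sub_C_eq_card, Finset.card_erase_of_mem hj₀T]
  have hpos : 0 < T.card := Finset.card_pos.mpr ⟨j₀, hj₀T⟩
  have key := bch_sum_mul_eval hq hβ hc (P := P) (by omega)
  have hne : P.coeff 3 * ∑ j : Fin (q + 1), algebraMap F K (c j) ≠ 0 := by
    rw [← key, Finset.sum_eq_single j₀]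
    · refine mul_ne_zero (mul_ne_zero ((_root_.map_ne_zero _).mpr hj₀) (inv_ne_zero
        (pow_ne_zero _ (ne_zero_of_pow_add_one (root_pow_card_add_one hβ _))))) ?_
      rw [hP, eval_prod]
      refine Finset.prod_ne_zero_iff.mpr fun j hj => ?_
      simp only [eval_sub, eval_X, eval_C]
      exact sub_ne_zero.mpr fun h => Finset.ne_of_mem_erase hj (root_injective hβ h).symm
    · intro j _ hj
      by_cases hjT : j ∈ T
      · have : P.eval (β ^ (j : ℕ)) = 0 := by
          rw [hP, eval_prod]
          exact Finset.prod_eq_zero (Finset.mem_erase.mpr ⟨hj, hjT⟩) (by simp)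
        rw [this, mul_zero]
      · have : c j = 0 := by simpa [hT] using hjT
        simp [this]
    · simp
  refine ⟨?_, fun h => hne ?_⟩
  · by_contra hlt
    exact hne (by rw [coeff_eq_zero_of_natDegree_lt (by omega), zero_mul])
  · rw [← map_sum, h, map_zero, mul_zero]

-- Let P vanish on the whole support. The functional kills P, XP and X²P, all of degree at most 6,
-- so P = X⁴ + const. As gcd(4, q+1) = 2, its roots in U form at most a pair ±v.
open Classical in
theorem bch_hammingNorm_ne_four (hq : Fintype.card F = q) {β : K} (h4 : 4 ∣ q - 1) (h9 : 9 ≤ q)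
    (hβ : IsPrimitiveRoot β (q + 1)) {c : Fin (q + 1) → F}
    (hc : c ∈ narrowSenseBCHCode F (q + 1) β 4) (hc0 : c ≠ 0) : hammingNorm c ≠ 4 := by
  intro hw
  obtain ⟨j₀, hj₀⟩ := Function.ne_iff.mp hc0
  set T : Finset (Fin (q + 1)) := Finset.univ.filter fun j => c j ≠ 0 with hT
  have hcard : T.card = 4 := by rw [← hw]; simp [hammingNorm, hT]
  have hj₀T : j₀ ∈ T := by simpa [hT] using hj₀
  set P : K[X] := ∏ j ∈ T, (X - C (β ^ (j : ℕ))) with hP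
  have hdeg : P.natDegree = 4 := by rw [hP, natDegree_finsetProd_X_sub_C_eq_card, hcard]
  have hmonic : P.Monic := monic_prod_X_sub_C _ _
  have hPz : ∀ j ∈ T, P.eval (β ^ (j : ℕ)) = 0 := by
    intro j hj
    rw [hP, eval_prod]
    exact Finset.prod_eq_zero hj (by simp)
  have hs : ∑ j : Fin (q + 1), algebraMap F K (c j) ≠ 0 := by
    rw [← map_sum]
    exact (_root_.map_ne_zero _).mpr
      (bch_coeff_three_mul_sum_ne_zero hq hβ hc hc0 (by omega)).2
  have hcoeff : ∀ k ≤ 2, P.coeff (3 - k) = 0 := by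
    intro k hk
    have hd : (P * X ^ k).natDegree < 7 := by
      rw [hmonic.natDegree_mul (monic_X_pow k), natDegree_X_pow, hdeg]; omega
    have key := bch_sum_mul_eval hq hβ hc hd
    rw [Finset.sum_eq_zero, eq_comm] at key
    · have := (mul_eq_zero.mp key).resolve_right hs
      rwa [coeff_mul_X_pow', if_pos (by omega)] at this
    · intro j _
      by_cases hjT : j ∈ T
      · simp [hPz j hjT]
      · have : c j = 0 := by simpa [hT] using hjT
        simp [this]
  have hP4 : P.coeff 4 = 1 := by rw [← hdeg]; exact hmonic
  have hpow : ∀ j ∈ T, (β ^ (j : ℕ)) ^ 4 = -P.coeff 0 := by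
    intro j hj
    have h := hPz j hj
    rw [eval_eq_sum_range' (n := 5) (by omega)] at h
    simp only [Finset.sum_range_succ, Finset.sum_range_zero, hP4] at h
    rw [hcoeff 0 (by omega), hcoeff 1 (by omega), hcoeff 2 (by omega)] at h
    linear_combination h
  set v := β ^ (j₀ : ℕ) with hv
  have hv0 : v ≠ 0 := ne_zero_of_pow_add_one (root_pow_card_add_one hβ _)
  have hsq : ∀ j ∈ T, β ^ (j : ℕ) = v ∨ β ^ (j : ℕ) = -v := by
    intro j hj
    have h1 : (β ^ (j : ℕ) / v) ^ 4 = 1 := by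
      rw [div_pow, hpow j hj, hv, hpow j₀ hj₀T, ← hpow j₀ hj₀T, div_self (pow_ne_zero _ hv0)]
    have h2 : (β ^ (j : ℕ) / v) ^ (q + 1) = 1 := by
      rw [div_pow, root_pow_card_add_one hβ, root_pow_card_add_one hβ, div_one]
    have h3 := pow_gcd_eq_one.mpr ⟨h1, h2⟩
    have hgcd : Nat.gcd 4 (q + 1) = 2 := by
      obtain ⟨m, hm⟩ : ∃ m, q + 1 = 2 + m * 4 := ⟨q / 4, by omega⟩
      simp [hm]
    rw [hgcd, div_pow, div_eq_one_iff_eq (pow_ne_zero _ hv0)] at h3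
    exact sq_eq_sq_iff_eq_or_eq_neg.mp h3
  have himg : T.image (fun j : Fin (q + 1) => β ^ (j : ℕ)) ⊆ {v, -v} := by
    intro x hx
    obtain ⟨j, hj, rfl⟩ := Finset.mem_image.mp hx
    simpa using hsq j hj
  have h5 := Finset.card_le_card himg
  rw [Finset.card_image_of_injective _ (root_injective hβ), hcard] at h5
  have := Finset.card_le_two (a := v) (b := -v)
  omega

open Classical in
/-- A `K`-linear dependency supported on a set `S` of `(q + 1)`-th roots of unity gives a word of
the BCH code over `F` supported on `S`. -/
theorem exists_bch_word (hq : Fintype.card F = q) (hK : Module.finrank F K = 2) {β : K}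
    (hβ : IsPrimitiveRoot β (q + 1)) (S : Finset K) (hS : ∀ u ∈ S, u ^ (q + 1) = 1)
    (E : Finset ℕ) (hE : E.card < S.card)
    (hred : ∀ d : K → K, (∀ k ∈ E, ∑ u ∈ S, d u * u ^ k = 0) →
      ∀ k < 7, k ≠ 3 → ∑ u ∈ S, d u * u ^ k = 0) :
    ∃ c ∈ narrowSenseBCHCode F (q + 1) β 4, c ≠ 0 ∧ hammingNorm c ≤ S.card := by
  have := finite_of_finrank_eq_two hK
  obtain ⟨d, hd, u₀, hu₀, hdu₀⟩ : ∃ d : K → K, (∀ k ∈ E, ∑ u ∈ S, d u * u ^ k = 0) ∧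
      ∃ u ∈ S, d u ≠ 0 := by
    let f : (S → K) →ₗ[K] (E → K) :=
      { toFun := fun g k => ∑ u : S, g u * (u : K) ^ (k : ℕ)
        map_add' := fun g h => by ext k; simp [add_mul, Finset.sum_add_distrib]
        map_smul' := fun r g => by ext k; simp [mul_assoc, Finset.mul_sum] }
    have hker : LinearMap.ker f ≠ ⊥ := by
      refine LinearMap.ker_ne_bot_of_finrank_lt ?_
      simpa using hE
    obtain ⟨g, hg, hg0⟩ := Submodule.exists_mem_ne_zero_of_ne_bot hker
    obtain ⟨u, hu⟩ := Function.ne_iff.mp hg0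
    refine ⟨fun x => if h : x ∈ S then g ⟨x, h⟩ else 0, fun k hk => ?_, u, u.2, ?_⟩
    · rw [← Finset.sum_coe_sort]
      have := congrFun (LinearMap.mem_ker.mp hg) ⟨k, hk⟩
      simpa [f] using this
    · simpa using hu
  have hall := hred d hd
  have hu₀0 := ne_zero_of_pow_add_one (hS u₀ hu₀)
  -- The word is c(u) = Tr(l d(u) u³): the factor u³ moves the centre of the exponents 0, ..., 6 to
  -- 0, and l keeps c nonzero at u₀.
  obtain ⟨l, hl⟩ : ∃ l : K, Algebra.trace F K (l * (d u₀ * u₀ ^ 3)) ≠ 0 := by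
    obtain ⟨y, hy⟩ := Algebra.trace_surjective F K 1
    have h0 : d u₀ * u₀ ^ 3 ≠ 0 := mul_ne_zero hdu₀ (pow_ne_zero _ hu₀0)
    refine ⟨y / (d u₀ * u₀ ^ 3), ?_⟩
    rw [div_mul_cancel₀ _ h0, hy]
    exact one_ne_zero
  let c : Fin (q + 1) → F := fun j =>
    if β ^ (j : ℕ) ∈ S then Algebra.trace F K (l * (d (β ^ (j : ℕ)) * (β ^ (j : ℕ)) ^ 3)) else 0
  have hsum : ∀ f : K → K, ∑ j : Fin (q + 1), (if β ^ (j : ℕ) ∈ S then f (β ^ (j : ℕ)) else 0) =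
      ∑ u ∈ S, f u := by
    intro f
    rw [← Finset.sum_filter]
    refine Finset.sum_bij (fun j _ => β ^ (j : ℕ)) (fun j hj => (Finset.mem_filter.mp hj).2)
      (fun i _ j _ h => root_injective hβ h) (fun u hu => ?_) (fun _ _ => rfl)
    obtain ⟨i, hi, rfl⟩ := hβ.eq_pow_of_pow_eq_one (hS u hu)
    exact ⟨⟨i, hi⟩, by simpa using hu, rfl⟩
  refine ⟨c, ?_, ?_, ?_⟩
  · rw [mem_bch_four_iff hβ.pow_eq_one]
    intro i h1 h3
    calc _ = ∑ j : Fin (q + 1), (if β ^ (j : ℕ) ∈ S then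
            (l * (d (β ^ (j : ℕ)) * (β ^ (j : ℕ)) ^ 3) +
              (l * (d (β ^ (j : ℕ)) * (β ^ (j : ℕ)) ^ 3)) ^ q) * (β ^ (j : ℕ)) ^ i else 0) := by
          refine Finset.sum_congr rfl fun j _ => ?_
          simp only [c]
          split_ifs
          · rw [algebraMap_trace_eq_add_pow hq hK]
          · simp
      _ = ∑ u ∈ S, (l * (d u * u ^ 3) + (l * (d u * u ^ 3)) ^ q) * u ^ i :=
          hsum fun u => (l * (d u * u ^ 3) + (l * (d u * u ^ 3)) ^ q) * u ^ i
      -- In the conjugate half of the trace, uⁱ = (u⁻ⁱ)^q, which produces the exponent 3 - i.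
      _ = l * ∑ u ∈ S, d u * u ^ (3 + i) + (l * ∑ u ∈ S, d u * u ^ (3 - i)) ^ q := by
          rw [mul_pow, sum_pow_card_field hq, Finset.mul_sum, Finset.mul_sum,
            ← Finset.sum_add_distrib]
          refine Finset.sum_congr rfl fun u hu => ?_
          have hu0 := ne_zero_of_pow_add_one (hS u hu)
          have e : u ^ i = (u ^ i)⁻¹ ^ q := by
            rw [inv_pow, ← pow_mul, mul_comm i, pow_mul, pow_eq_inv_of_pow_add_one (hS u hu),
              inv_pow, inv_inv]
          have e3 : u ^ (3 - i) = u ^ 3 * (u ^ i)⁻¹ := by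
            rw [pow_sub₀ u hu0 h3]
          rw [e3, add_mul, pow_add, ← mul_assoc (d u) _ (u ^ i)⁻¹, mul_pow _ (u ^ i)⁻¹, ← e]
          ring
      _ = 0 := by
          rw [hall (3 + i) (by omega) (by omega), hall (3 - i) (by omega) (by omega), mul_zero,
            zero_pow (by rw [← hq]; exact Fintype.card_ne_zero), add_zero]
  · obtain ⟨i, hi, hiu⟩ := hβ.eq_pow_of_pow_eq_one (hS u₀ hu₀)
    refine Function.ne_iff.mpr ⟨⟨i, hi⟩, ?_⟩
    simp only [c, hiu, if_pos hu₀]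
    exact hl
  · rw [hammingNorm, ← Finset.card_image_of_injective _ (root_injective hβ)]
    refine Finset.card_le_card fun x hx => ?_
    obtain ⟨j, hj, rfl⟩ := Finset.mem_image.mp hx
    by_contra h
    simp [c, h] at hj

/-- On fourth roots of unity the exponents 4, 5, 6 repeat 0, 1, 2: three conditions on four
unknowns. -/
theorem exists_bch_word_four (hq : Fintype.card F = q) (hK : Module.finrank F K = 2) {β : K}
    (hβ : IsPrimitiveRoot β (q + 1)) (h4 : 4 ∣ q + 1) :
    ∃ c ∈ narrowSenseBCHCode F (q + 1) β 4, c ≠ 0 ∧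
      (open Classical in hammingNorm c) ≤ 4 := by
  obtain ⟨m, hm⟩ := h4
  have hp : IsPrimitiveRoot (β ^ m) 4 := hβ.pow (by omega) (by rw [hm, mul_comm])
  have hc := hp.card_nthRootsFinset
  have hmem : ∀ u ∈ nthRootsFinset 4 (1 : K), u ^ 4 = 1 := fun u hu => by
    rwa [mem_nthRootsFinset (by norm_num)] at hu
  have key := exists_bch_word hq hK hβ (nthRootsFinset 4 (1 : K))
    (fun u hu => by rw [hm, pow_mul, hmem u hu, one_pow]) {0, 1, 2} (by rw [hc]; decide)
  rw [hc] at key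
  refine key ?_
  · intro d hd k hk hk3
    have hstep : ∀ k, ∑ u ∈ nthRootsFinset 4 (1 : K), d u * u ^ (k + 4) =
        ∑ u ∈ nthRootsFinset 4 (1 : K), d u * u ^ k := fun k =>
      Finset.sum_congr rfl fun u hu => by rw [pow_add, hmem u hu, mul_one]
    have h0 := hd 0 (by simp)
    have h1 := hd 1 (by simp)
    have h2 := hd 2 (by simp)
    interval_cases k
    exacts [h0, h1, h2, absurd rfl hk3, (hstep 0).trans h0, (hstep 1).trans h1,
      (hstep 2).trans h2]

/-- Four conditions on five unknowns. The recurrence gets exponent 5 from 4, 1, 0 and exponent 6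
from 5, 2, 1, never using 3. -/
theorem exists_bch_word_five (hq : Fintype.card F = q) (h9 : 9 ≤ q)
    (hK : Module.finrank F K = 2) {β : K}
    (hβ : IsPrimitiveRoot β (q + 1)) (h4 : 4 ∣ q - 1) :
    ∃ c ∈ narrowSenseBCHCode F (q + 1) β 4, c ≠ 0 ∧
      (open Classical in hammingNorm c) ≤ 5 := by
  obtain ⟨S, hc, hS, a, b, e, hrel⟩ := exists_five_unit_roots hq h9 hK hβ h4
  rw [← hc]
  refine exists_bch_word hq hK hβ S hS {0, 1, 2, 4} (by rw [hc]; decide) ?_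
  intro d hd k hk hk3
  have hstep : ∀ k, ∑ u ∈ S, d u * u ^ (k + 5) = a * ∑ u ∈ S, d u * u ^ (k + 4) +
      b * ∑ u ∈ S, d u * u ^ (k + 1) + e * ∑ u ∈ S, d u * u ^ k := fun k => by
    rw [Finset.mul_sum, Finset.mul_sum, Finset.mul_sum, ← Finset.sum_add_distrib,
      ← Finset.sum_add_distrib]
    exact Finset.sum_congr rfl fun u hu => by rw [pow_add, hrel u hu]; ring
  have h0 := hd 0 (by simp)
  have h1 := hd 1 (by simp)
  have h2 := hd 2 (by simp)
  have h4 := hd 4 (by simp)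
  have h5 : ∑ u ∈ S, d u * u ^ 5 = 0 := by rw [hstep 0, h4, h1, h0]; ring
  have h6 : ∑ u ∈ S, d u * u ^ 6 = 0 := by rw [hstep 1, h5, h2, h1]; ring
  interval_cases k
  exacts [h0, h1, h2, absurd rfl hk3, h4, h5, h6]

end BCHWeights

/-! ### Minimum distance and duality for linear codes. -/

section CodeParameters

variable {F : Type*} [Field F]

open Classical in
theorem hasMinDist_iff {n : ℕ} (C : Submodule F (Fin n → F)) (d : ℕ) :
    HasMinDist C d ↔ (∃ x ∈ C, x ≠ 0 ∧ hammingNorm x = d) ∧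
      ∀ x ∈ C, x ≠ 0 → d ≤ hammingNorm x := by
  unfold HasMinDist IsLeast
  refine and_congr ⟨?_, ?_⟩ ⟨?_, ?_⟩
  · rintro ⟨x, hx, y, hy, hxy, h⟩
    exact ⟨-x + y, C.add_mem (C.neg_mem hx) hy, fun h => hxy (neg_add_eq_zero.mp h),
      by rw [← h, hammingDist_eq_hammingNorm]⟩
  · rintro ⟨x, hx, hx0, h⟩
    exact ⟨x, hx, 0, C.zero_mem, hx0, by rw [hammingDist_zero_right, h]⟩
  · intro h x hx hx0
    exact h ⟨x, hx, 0, C.zero_mem, hx0, hammingDist_zero_right x⟩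
  · rintro h w ⟨x, hx, y, hy, hxy, rfl⟩
    rw [hammingDist_eq_hammingNorm]
    exact h _ (C.add_mem (C.neg_mem hx) hy) fun h => hxy (neg_add_eq_zero.mp h)

open Classical in
theorem hammingNorm_eq_castSucc_add {n : ℕ} (y : Fin (n + 1) → F) :
    hammingNorm y = hammingNorm (fun i : Fin n => y i.castSucc) +
      if y (Fin.last n) = 0 then 0 else 1 := by
  simp only [hammingNorm, Finset.card_filter, Fin.sum_univ_castSucc]
  congr 1
  split_ifs <;> simp_all

open Classical in
theorem hammingNorm_add_card_zeros {n : ℕ} (x : Fin n → F) :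
    hammingNorm x + (Finset.univ.filter fun i => x i = 0).card = n := by
  have := Finset.card_filter_add_card_filter_not (s := (Finset.univ : Finset (Fin n)))
    (fun i => x i = 0)
  rw [Finset.card_univ, Fintype.card_fin] at this
  simp only [hammingNorm, ne_eq]
  omega

theorem mem_dualCode_iff {n : ℕ} (C : Submodule F (Fin n → F)) (y : Fin n → F) :
    y ∈ dualCode C ↔ ∀ x ∈ C, ∑ i, x i * y i = 0 := Iff.rfl

theorem nondegenerate_dotProductBilin (n : ℕ) :
    LinearMap.BilinForm.Nondegenerate (dotProductBilin F F : LinearMap.BilinForm F (Fin n → F)) := by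
  constructor
  · intro x hx
    exact dotProduct_eq_zero x hx
  · intro x hx
    exact dotProduct_eq_zero x fun y => by rw [dotProduct_comm]; exact hx y

theorem dualCode_dualCode {n : ℕ} (C : Submodule F (Fin n → F)) : dualCode (dualCode C) = C :=
  LinearMap.BilinForm.orthogonal_orthogonal (nondegenerate_dotProductBilin n)
    (fun x y h => by rw [dotProductBilin_apply_apply, dotProduct_comm]; exact h) C

theorem finrank_dualCode {n : ℕ} (C : Submodule F (Fin n → F)) :
    Module.finrank F (dualCode C) = n - Module.finrank F C := by
  have := LinearMap.BilinForm.finrank_orthogonal (nondegenerate_dotProductBilin (F := F) n) C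
  rw [Module.finrank_fin_fun] at this
  exact this

end CodeParameters

/-! ### Trace words, their zeros and their duality with the BCH code. -/

section TraceCodes

variable {F K : Type*} [Field F] [Field K] [Algebra F K] {q : ℕ}

variable (F) in
/-- The trace words `(Tr (a₁ u + a₂ u² + a₃ u³))_u`, where `u` runs through the powers of `β`. -/
noncomputable def traceWord (q : ℕ) (β : K) : (Fin 3 → K) →ₗ[F] (Fin (q + 1) → F) where
  toFun a j := Algebra.trace F K (∑ k : Fin 3, a k * (β ^ (j : ℕ)) ^ (k + 1 : ℕ))
  map_add' a b := by
    ext j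
    simp [add_mul, Finset.sum_add_distrib]
  map_smul' r a := by
    ext j
    simp [Finset.mul_sum]

variable (F) in
/-- The words `(a₀ + Tr (a₁ u + a₂ u² + a₃ u³))_u`, followed by `-a₀`. -/
noncomputable def extendedTraceWord (q : ℕ) (β : K) : (F × (Fin 3 → K)) →ₗ[F] (Fin (q + 1 + 1) → F) where
  toFun a := Fin.snoc (α := fun _ => F) (fun j => a.1 + traceWord F q β a.2 j) (-a.1)
  map_add' a b := by
    ext j
    refine Fin.lastCases ?_ (fun i => ?_) j
    · simp [add_comm]
    · simp; ring
  map_smul' r a := by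
    ext j
    refine Fin.lastCases ?_ (fun i => ?_) j
    · simp
    · simp; ring

variable [Fintype F]

theorem algebraMap_traceWord (hq : Fintype.card F = q) (hK : Module.finrank F K = 2) {β : K}
    (hβ : IsPrimitiveRoot β (q + 1)) (a : Fin 3 → K) (j : Fin (q + 1)) :
    algebraMap F K (traceWord F q β a j) =
      ∑ k : Fin 3, (a k * (β ^ (j : ℕ)) ^ (k + 1 : ℕ) +
        a k ^ q * ((β ^ (j : ℕ)) ^ (k + 1 : ℕ))⁻¹) := by
  simp only [traceWord, LinearMap.coe_mk, AddHom.coe_mk]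
  rw [algebraMap_trace_eq_add_pow hq hK, sum_pow_card_field hq, ← Finset.sum_add_distrib]
  refine Finset.sum_congr rfl fun k _ => ?_
  rw [mul_pow, ← pow_mul _ _ q, mul_comm _ q, pow_mul _ q,
    pow_eq_inv_of_pow_add_one (root_pow_card_add_one hβ _), inv_pow]

-- Times u³ the word becomes a polynomial of degree at most 6; its coefficients from X³ up are a₀
-- and the entries of a, so it is not zero.
open Classical in
theorem card_zeros_add_traceWord_le (hq : Fintype.card F = q) (hK : Module.finrank F K = 2) {β : K}
    (hβ : IsPrimitiveRoot β (q + 1)) (a₀ : F) (a : Fin 3 → K) (ha : a₀ ≠ 0 ∨ a ≠ 0) :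
    (Finset.univ.filter fun j => a₀ + traceWord F q β a j = 0).card ≤ 6 := by
  obtain ⟨b, hb⟩ : ∃ b : Fin 3 → K, ∀ k, b k = a k ^ q := ⟨fun k => a k ^ q, fun _ => rfl⟩
  set P : K[X] := C (a 2) * X ^ 6 + C (a 1) * X ^ 5 + C (a 0) * X ^ 4 + C (algebraMap F K a₀) * X ^ 3
    + C (b 0) * X ^ 2 + C (b 1) * X + C (b 2) with hP
  have hdeg : P.natDegree ≤ 6 := by rw [hP]; compute_degree
  have hP0 : P ≠ 0 := by
    intro h
    have h3 : P.coeff 3 = algebraMap F K a₀ := by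
      rw [hP]; simp [coeff_X_pow]
    have h4 : P.coeff 4 = a 0 := by rw [hP]; simp [coeff_X_pow]
    have h5 : P.coeff 5 = a 1 := by rw [hP]; simp [coeff_X_pow]
    have h6 : P.coeff 6 = a 2 := by rw [hP]; simp [coeff_X_pow]
    rw [h, coeff_zero] at h3 h4 h5 h6
    rcases ha with ha | ha
    · exact ha ((map_eq_zero _).mp h3.symm)
    · apply ha
      ext k
      fin_cases k
      exacts [h4.symm, h5.symm, h6.symm]
  have hroot : (Finset.univ.filter fun j => a₀ + traceWord F q β a j = 0).image
      (fun j : Fin (q + 1) => β ^ (j : ℕ)) ⊆ P.roots.toFinset := by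
    intro x hx
    obtain ⟨j, hj, rfl⟩ := Finset.mem_image.mp hx
    have hj' := congrArg (algebraMap F K) (Finset.mem_filter.mp hj).2
    rw [map_add, algebraMap_traceWord hq hK hβ, map_zero] at hj'
    rw [Multiset.mem_toFinset, mem_roots hP0, IsRoot.def, hP]
    have hv := ne_zero_of_pow_add_one (root_pow_card_add_one hβ (j : ℕ))
    simp only [eval_add, eval_mul, eval_C, eval_pow, eval_X]
    simp only [Fin.sum_univ_three, Fin.val_zero, Fin.val_one, Fin.val_two, ← hb] at hj'
    norm_num at hj'
    field_simp at hj'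
    linear_combination hj'
  calc _ = _ := (Finset.card_image_of_injective _ (root_injective hβ)).symm
    _ ≤ _ := Finset.card_le_card hroot
    _ ≤ _ := (Multiset.toFinset_card_le _).trans ((card_roots' _).trans hdeg)

open Classical in
theorem le_hammingNorm_add_traceWord (hq : Fintype.card F = q) (hK : Module.finrank F K = 2) {β : K}
    (hβ : IsPrimitiveRoot β (q + 1)) (a₀ : F) (a : Fin 3 → K) (ha : a₀ ≠ 0 ∨ a ≠ 0) :
    q - 5 ≤ hammingNorm fun j => a₀ + traceWord F q β a j := by
  have h1 := card_zeros_add_traceWord_le hq hK hβ a₀ a ha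
  have h2 := hammingNorm_add_card_zeros fun j => a₀ + traceWord F q β a j
  omega

open Classical in
/-- A trace word with six zeros, from
`u³ - u⁻³ - e (u - u⁻¹) = (u - u⁻¹) (u² - β²) (1 - β⁻² u⁻²)`, `e = 1 + β² + β⁻²`. -/
theorem exists_hammingNorm_traceWord_le (hq : Fintype.card F = q) (hodd : Odd q) (h9 : 9 ≤ q)
    (hK : Module.finrank F K = 2) {β : K} (hβ : IsPrimitiveRoot β (q + 1)) :
    ∃ a : Fin 3 → K, a ≠ 0 ∧ hammingNorm (traceWord F q β a) ≤ q - 5 := by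
  have hβ1 : β ^ (q + 1) = 1 := hβ.pow_eq_one
  have hβ0 : β ≠ 0 := ne_zero_of_pow_add_one hβ1
  have hβq : β ^ q = β⁻¹ := pow_eq_inv_of_pow_add_one hβ1
  set l := β - β⁻¹ with hl
  have hl0 : l ≠ 0 := by
    intro h
    have h2 : β ^ 2 = 1 := by
      rw [hl] at h; field_simp at h; linear_combination h
    exact hβ.pow_ne_one_of_pos_of_lt (by norm_num) (by omega) h2
  have hneg : ∀ x y : K, (x - y) ^ q = x ^ q - y ^ q := by
    intro x y
    rw [sub_eq_add_neg, add_pow_card_field hq, hodd.neg_pow, ← sub_eq_add_neg]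
  have hlq : l ^ q = -l := by
    rw [hl, hneg, inv_pow, hβq, inv_inv]; ring
  set e := 1 + β ^ 2 + (β ^ 2)⁻¹ with he
  have heq : e ^ q = e := by
    rw [he, add_pow_card_field hq, add_pow_card_field hq, one_pow, inv_pow, ← pow_mul,
      mul_comm 2 q, pow_mul, hβq, inv_pow, inv_inv]
    ring
  -- Since l^q = -l and e^q = e, the factor l turns the antisymmetric expression in u and u⁻¹ into a
  -- trace.
  set a : Fin 3 → K := ![-(l * e), 0, l] with ha
  have hword : ∀ j : Fin (q + 1), (β ^ (j : ℕ) = 1 ∨ β ^ (j : ℕ) = -1 ∨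
      (β ^ (j : ℕ)) ^ 2 = β ^ 2 ∨ (β ^ (j : ℕ)) ^ 2 = (β ^ 2)⁻¹) → traceWord F q β a j = 0 := by
    intro j hj
    apply (algebraMap F K).injective
    rw [algebraMap_traceWord hq hK hβ, map_zero]
    have hv := ne_zero_of_pow_add_one (root_pow_card_add_one hβ (j : ℕ))
    generalize β ^ (j : ℕ) = v at *
    have hle : (-(l * e)) ^ q = l * e := by
      rw [hodd.neg_pow, mul_pow, hlq, heq]; ring
    have ha0 : a 0 = -(l * e) := rfl
    have ha1 : a 1 = 0 := rfl
    have ha2 : a 2 = l := rfl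
    simp only [Fin.sum_univ_three, ha0, ha1, ha2, Fin.val_zero, Fin.val_one, Fin.val_two]
    rw [hle, hlq, zero_pow (by omega)]
    have hfac : (v ^ 2 - 1) * (v ^ 2 - β ^ 2) * (v ^ 2 - (β ^ 2)⁻¹) = 0 := by
      rcases hj with h | h | h | h <;> simp [h]
    have hfac' : (v ^ 2 - 1) * (v ^ 2 - β ^ 2) * (v ^ 2 - (β ^ 2)⁻¹) =
        v ^ 6 - e * v ^ 4 + e * v ^ 2 - 1 := by
      rw [he]; field_simp; ring
    rw [hfac'] at hfac
    clear_value l e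
    calc _ = l * (v ^ 6 - e * v ^ 4 + e * v ^ 2 - 1) * (v ^ 3)⁻¹ := by field_simp; ring
      _ = 0 := by rw [hfac, mul_zero, zero_mul]
  refine ⟨a, fun h => hl0 (congrFun h 2), ?_⟩
  obtain ⟨h, hh⟩ : ∃ h, q + 1 = 2 * h := by
    obtain ⟨m, hm⟩ := hodd
    exact ⟨m + 1, by omega⟩
  have hβh : β ^ h = -1 := by
    have : (β ^ h) ^ 2 = 1 := by rw [← pow_mul, mul_comm, ← hh, hβ1]
    rcases sq_eq_one_iff.mp this with h1 | h1
    · exact absurd h1 (hβ.pow_ne_one_of_pos_of_lt (by omega) (by omega))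
    · exact h1
  -- As β^h = -1, these exponents give 1, β, β⁻¹, -1, -β, -β⁻¹.
  have hsub : ({0, 1, q, h, h + 1, h - 1} : Finset ℕ) ⊆
      (Finset.univ.filter fun j => traceWord F q β a j = 0).image Fin.val := by
    intro j hj
    have hlt : j < q + 1 := by
      simp only [Finset.mem_insert, Finset.mem_singleton] at hj
      omega
    refine Finset.mem_image.mpr ⟨⟨j, hlt⟩, Finset.mem_filter.mpr ⟨Finset.mem_univ _, ?_⟩, rfl⟩
    apply hword
    simp only [Finset.mem_insert, Finset.mem_singleton] at hj
    rcases hj with rfl | rfl | rfl | rfl | rfl | rfl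
    · simp
    · simp
    · right; right; right; simp [hβq]
    · right; left; exact hβh
    · right; right; left
      simp only [pow_succ β, hβh]; ring
    · right; right; right
      have : β ^ (h - 1) = -β⁻¹ := by
        rw [pow_sub₀ β hβ0 (by omega), hβh]; simp
      simp [this]
  have hc := (Finset.card_le_card hsub).trans Finset.card_image_le
  have hc6 : ({0, 1, q, h, h + 1, h - 1} : Finset ℕ).card = 6 := by
    have : 5 ≤ h := by omega
    rw [Finset.card_insert_of_notMem, Finset.card_insert_of_notMem, Finset.card_insert_of_notMem,
      Finset.card_insert_of_notMem, Finset.card_insert_of_notMem, Finset.card_singleton]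
    all_goals
      simp only [Finset.mem_insert, Finset.mem_singleton]
      omega
  have := hammingNorm_add_card_zeros (traceWord F q β a)
  omega

theorem injective_extendedTraceWord (hq : Fintype.card F = q) (h9 : 9 ≤ q)
    (hK : Module.finrank F K = 2) {β : K} (hβ : IsPrimitiveRoot β (q + 1)) :
    Function.Injective (extendedTraceWord F q β) := by
  classical
  rw [injective_iff_map_eq_zero]
  rintro ⟨a₀, a⟩ h
  by_contra hne
  have hz : ∀ j, a₀ + traceWord F q β a j = 0 := fun j => by
    have := congrFun h j.castSucc
    simpa [extendedTraceWord] using this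
  have h1 := card_zeros_add_traceWord_le hq hK hβ a₀ a (by
    by_contra! hcon
    exact hne (Prod.ext hcon.1 hcon.2))
  simp only [hz, Finset.filter_true, Finset.card_univ, Fintype.card_fin] at h1
  omega

theorem injective_traceWord (hq : Fintype.card F = q) (h9 : 9 ≤ q)
    (hK : Module.finrank F K = 2) {β : K} (hβ : IsPrimitiveRoot β (q + 1)) :
    Function.Injective (traceWord F q β) := by
  rw [injective_iff_map_eq_zero]
  intro a ha
  have h : extendedTraceWord F q β (0, a) = extendedTraceWord F q β 0 := by
    rw [map_zero]
    ext j
    refine Fin.lastCases ?_ (fun i => ?_) j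
    · simp [extendedTraceWord]
    · simp [extendedTraceWord, ha]
  exact (Prod.ext_iff.mp (injective_extendedTraceWord hq h9 hK hβ h)).2

/-- Delsarte duality: c pairs with a trace word to the trace of a K-linear form in a, whose
coefficients are the power sums of c. The a are arbitrary and the trace is onto, so the pairing
vanishes iff the power sums do. -/
theorem narrowSenseBCHCode_four_eq_dualCode (hK : Module.finrank F K = 2) {β : K}
    (hβ : IsPrimitiveRoot β (q + 1)) :
    narrowSenseBCHCode F (q + 1) β 4 = dualCode (LinearMap.range (traceWord F q β)) := by
  have := finite_of_finrank_eq_two hK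
  ext c
  rw [mem_bch_four_iff hβ.pow_eq_one, mem_dualCode_iff]
  have key : ∀ a : Fin 3 → K, ∑ j, traceWord F q β a j * c j = Algebra.trace F K
      (∑ k : Fin 3, a k * ∑ j : Fin (q + 1), algebraMap F K (c j) * (β ^ (j : ℕ)) ^ (k + 1 : ℕ)) := by
    intro a
    simp_rw [Finset.mul_sum]
    rw [Finset.sum_comm, map_sum]
    refine Finset.sum_congr rfl fun j _ => ?_
    rw [mul_comm, ← smul_eq_mul]
    simp only [traceWord, LinearMap.coe_mk, AddHom.coe_mk]
    rw [← map_smul, Algebra.smul_def, Finset.mul_sum]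
    congr 1
    exact Finset.sum_congr rfl fun k _ => by ring
  constructor
  · rintro h _ ⟨a, rfl⟩
    rw [key, Finset.sum_eq_zero, map_zero]
    intro k _
    rw [h (k + 1) (by omega) (by omega), mul_zero]
  · intro h i h1 h3
    by_contra hne
    obtain ⟨y, hy⟩ := Algebra.trace_surjective F K 1
    set s := ∑ j : Fin (q + 1), algebraMap F K (c j) * (β ^ (j : ℕ)) ^ i with hs
    have hk := h _ ⟨Pi.single (⟨i - 1, by omega⟩ : Fin 3) (y / s), rfl⟩
    rw [key, Finset.sum_eq_single (⟨i - 1, by omega⟩ : Fin 3)] at hk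
    · simp only [Pi.single_eq_same, Nat.sub_add_cancel h1] at hk
      rw [← hs, div_mul_cancel₀ _ hne, hy] at hk
      exact one_ne_zero hk
    · intro k _ hk'
      rw [Pi.single_eq_of_ne hk', zero_mul]
    · simp

end TraceCodes

/-! ### The extended code as a code of trace words, by Fourier transform on U. -/

section ClassicalMDSCode

variable {F K : Type*} [Field F] [Field K] [Algebra F K] {q : ℕ}

theorem not_dvd_of_between {n t m : ℕ} (h1 : n * t < m) (h2 : m < n * (t + 1)) : ¬ n ∣ m := by
  rintro ⟨s, rfl⟩
  have h3 := Nat.lt_of_mul_lt_mul_left h1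
  have h4 := Nat.lt_of_mul_lt_mul_left h2
  omega

theorem sum_root_pow_eq_zero {β : K} (hβ : IsPrimitiveRoot β (q + 1)) {m : ℕ} (hm : ¬ q + 1 ∣ m) :
    ∑ j : Fin (q + 1), (β ^ (j : ℕ)) ^ m = 0 := by
  have h1 : β ^ m ≠ 1 := fun h => hm (hβ.dvd_of_pow_eq_one m h)
  have e : ∑ j : Fin (q + 1), (β ^ (j : ℕ)) ^ m = ∑ j ∈ Finset.range (q + 1), (β ^ m) ^ j := by
    rw [← Fin.sum_univ_eq_sum_range (fun j => (β ^ m) ^ j)]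
    exact Finset.sum_congr rfl fun j _ => by rw [← pow_mul, ← pow_mul, mul_comm]
  rw [e, geom_sum_eq h1, root_pow_card_add_one hβ, sub_self, zero_div]

theorem eq_zero_of_forall_sum_eq_zero {β : K} (hβ : IsPrimitiveRoot β (q + 1))
    (c : Fin (q + 1) → F)
    (h : ∀ i ≤ q, ∑ j : Fin (q + 1), algebraMap F K (c j) * (β ^ (j : ℕ)) ^ i = 0) : c = 0 := by
  set P : K[X] := ∑ j : Fin (q + 1), C (algebraMap F K (c j)) * X ^ (j : ℕ) with hP
  have hdeg : P.natDegree < Fintype.card (Fin (q + 1)) := by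
    rw [Fintype.card_fin, Nat.lt_succ_iff, hP]
    exact natDegree_sum_le_of_forall_le _ _ fun j _ =>
      (natDegree_C_mul_X_pow_le _ _).trans (Nat.lt_succ_iff.mp j.2)
  have hP0 : P = 0 := by
    refine eq_zero_of_natDegree_lt_card_of_eval_eq_zero P (root_injective hβ) (fun i => ?_) hdeg
    rw [← h i (Nat.lt_succ_iff.mp i.2), hP, eval_finsetSum]
    refine Finset.sum_congr rfl fun j _ => ?_
    simp only [eval_mul, eval_C, eval_pow, eval_X]
    rw [← pow_mul, ← pow_mul, mul_comm (i : ℕ)]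
  ext j
  have hcoeff : P.coeff j = algebraMap F K (c j) := by
    rw [hP, finsetSum_coeff, Finset.sum_eq_single j]
    · simp
    · intro i _ hij
      rw [coeff_C_mul_X_pow, if_neg (fun h => hij (Fin.ext h.symm))]
    · simp
  rw [hP0, coeff_zero] at hcoeff
  exact (map_eq_zero _).mp hcoeff.symm

variable [Fintype F]

/-- The conjugates of βⁱ are β^{±i}, and 0 < i + j < q + 1 excludes j ≡ -i. -/
theorem minpoly_root_ne (hq : Fintype.card F = q) {β : K} (hβ : IsPrimitiveRoot β (q + 1))
    (h2 : (2 : F) ≠ 0) (hK : Module.finrank F K = 2)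
    {i j : ℕ} (hi0 : 0 < i) (hj : 2 * j ≤ q + 1) (hij : i < j) :
    minpoly F (β ^ i) ≠ minpoly F (β ^ j) := by
  intro h
  have hij' : aeval (β ^ j) (minpoly F (β ^ i)) = 0 := by rw [h, minpoly.aeval]
  have hγ := root_pow_card_add_one hβ i
  have hγ0 := ne_zero_of_pow_add_one hγ
  have hfix : (β ^ i + (β ^ i)⁻¹) ^ q = β ^ i + (β ^ i)⁻¹ := by
    rw [add_pow_card_field hq, inv_pow, pow_eq_inv_of_pow_add_one hγ, inv_inv, add_comm]
  obtain ⟨s, hs⟩ := exists_algebraMap_eq_of_pow_card_eq_self hq hK h2 hfix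
  have hdvd : minpoly F (β ^ i) ∣ X ^ 2 - C s * X + 1 := by
    apply minpoly.dvd
    simp only [map_add, map_sub, map_mul, map_pow, aeval_X, aeval_C, map_one, hs]
    field_simp
    ring
  obtain ⟨g, hg⟩ := hdvd
  have h0 : aeval (β ^ j) (X ^ 2 - C s * X + 1 : F[X]) = 0 := by rw [hg, map_mul, hij', zero_mul]
  simp only [map_add, map_sub, map_mul, map_pow, aeval_X, aeval_C, map_one, hs] at h0
  have hfac : (β ^ j - β ^ i) * (β ^ j - (β ^ i)⁻¹) = 0 := by
    rw [← h0]; field_simp; ring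
  rcases mul_eq_zero.mp hfac with h1 | h1
  · exact hij.ne' (hβ.pow_inj (by omega) (by omega) (sub_eq_zero.mp h1))
  · have : β ^ (j + i) = 1 := by
      rw [pow_add, sub_eq_zero.mp h1, inv_mul_cancel₀ hγ0]
    exact hβ.pow_ne_one_of_pos_of_lt (by omega) (by omega) this

/-- Up to (q+1)/2 the minimal polynomials are distinct irreducibles, so divisibility by the product
is divisibility by each. -/
theorem mem_classicalMDSCode_iff (hq : Fintype.card F = q) {β : K}
    (hβ : IsPrimitiveRoot β (q + 1)) (h2 : (2 : F) ≠ 0) (hK : Module.finrank F K = 2)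
    {u : ℕ} (hu : 0 < u) (c : Fin (q + 1) → F) :
    c ∈ classicalMDSCode F q β u ↔ ∀ i ∈ Finset.Icc u ((q + 1) / 2),
      ∑ j : Fin (q + 1), algebraMap F K (c j) * (β ^ (j : ℕ)) ^ i = 0 := by
  have := finite_of_finrank_eq_two hK
  refine mem_cyclicCode_iff_forall_sum hβ.pow_eq_one _ (fun p => ?_) c
  constructor
  · intro h i hi
    exact minpoly.dvd_iff.mp ((Finset.dvd_prod_of_mem _ hi).trans h)
  · intro h
    refine Finset.prod_dvd_of_coprime ?_ fun i hi => minpoly.dvd_iff.mpr (h i hi)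
    have hint : ∀ x : K, IsIntegral F x := fun x => Algebra.IsIntegral.isIntegral x
    have hcop : ∀ i ∈ Finset.Icc u ((q + 1) / 2), ∀ j ∈ Finset.Icc u ((q + 1) / 2), i < j →
        IsCoprime (minpoly F (β ^ i)) (minpoly F (β ^ j)) := by
      intro i hi j hj hij
      rw [Finset.mem_Icc] at hi hj
      rw [(minpoly.irreducible (hint _)).coprime_iff_not_dvd]
      intro hd
      refine minpoly_root_ne hq hβ h2 hK (i := i) (j := j) (by omega) (by omega) hij ?_
      exact eq_of_monic_of_associated (minpoly.monic (hint _)) (minpoly.monic (hint _))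
        ((minpoly.irreducible (hint _)).associated_of_dvd (minpoly.irreducible (hint _)) hd)
    intro i hi j hj hij
    rcases lt_or_gt_of_ne hij with h | h
    · exact hcop i hi j hj h
    · exact (hcop j hj i hi h).symm

theorem sum_add_traceWord_mul_pow (hq : Fintype.card F = q) (hK : Module.finrank F K = 2) {β : K}
    (hβ : IsPrimitiveRoot β (q + 1)) (a₀ : F) (a : Fin 3 → K) (i : ℕ) :
    ∑ j : Fin (q + 1), algebraMap F K (a₀ + traceWord F q β a j) * (β ^ (j : ℕ)) ^ i =
      algebraMap F K a₀ * ∑ j : Fin (q + 1), (β ^ (j : ℕ)) ^ i +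
      ∑ k : Fin 3, (a k * ∑ j : Fin (q + 1), (β ^ (j : ℕ)) ^ (i + k + 1) +
        a k ^ q * ∑ j : Fin (q + 1), (β ^ (j : ℕ)) ^ (i + (q + 1 - (k + 1)))) := by
  simp_rw [Finset.mul_sum, ← Finset.sum_add_distrib]
  rw [Finset.sum_comm, ← Finset.sum_add_distrib]
  refine Finset.sum_congr rfl fun j _ => ?_
  rw [map_add, algebraMap_traceWord hq hK hβ, add_mul, Finset.sum_mul]
  congr 1
  have : 1 < Fintype.card F := Fintype.one_lt_card
  refine Finset.sum_congr rfl fun k _ => ?_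
  have hv := root_pow_card_add_one hβ (j : ℕ)
  rw [pow_add _ i (q + 1 - (k + 1)), pow_sub₀ _ (ne_zero_of_pow_add_one hv) (by omega), hv]
  ring

theorem sum_root_pow_eq_one_of_dvd (hq : Fintype.card F = q) {β : K} {m : ℕ}
    (hβ : IsPrimitiveRoot β (q + 1)) (hm : q + 1 ∣ m) :
    ∑ j : Fin (q + 1), (β ^ (j : ℕ)) ^ m = 1 := by
  obtain ⟨t, rfl⟩ := hm
  have h : ∀ j : Fin (q + 1), (β ^ (j : ℕ)) ^ ((q + 1) * t) = 1 := fun j => by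
    rw [pow_mul, root_pow_card_add_one hβ, one_pow]
  have hq0 : (q : K) = 0 := by
    rw [← map_natCast (algebraMap F K), ← hq, FiniteField.cast_card_eq_zero, map_zero]
  simp [h, hq0]

/-- A word is determined by its transform at frequencies 0, ..., q, and Frobenius relates i to -i,
so 0, ..., (q+1)/2 suffice. On a₀ + Tr(...) the transform is a₀ at 0 (as q + 1 = 1 in K), the q-th
powers of the entries of a at 1, 2, 3, and 0 from 4 to (q+1)/2. -/
theorem extendedCode_classicalMDSCode_eq_range (hq : Fintype.card F = q) (hodd : Odd q) (h9 : 9 ≤ q)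
    (hK : Module.finrank F K = 2) {β : K} (hβ : IsPrimitiveRoot β (q + 1)) :
    extendedCode (classicalMDSCode F q β 4) = LinearMap.range (extendedTraceWord F q β) := by
  have h2 : (2 : F) ≠ 0 := Ring.two_ne_zero (ringChar_ne_two_of_odd_card (by rwa [hq]))
  have hG : ∀ {m : ℕ} (t : ℕ), (q + 1) * t < m → m < (q + 1) * (t + 1) →
      ∑ j : Fin (q + 1), (β ^ (j : ℕ)) ^ m = 0 := fun t h1 h2 =>
    sum_root_pow_eq_zero hβ (not_dvd_of_between h1 h2)
  have hzero : ∀ (a₀ : F) (a : Fin 3 → K), ∑ j : Fin (q + 1),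
      algebraMap F K (a₀ + traceWord F q β a j) * (β ^ (j : ℕ)) ^ 0 = algebraMap F K a₀ := by
    intro a₀ a
    rw [sum_add_traceWord_mul_pow hq hK hβ, sum_root_pow_eq_one_of_dvd hq hβ (dvd_zero _), mul_one,
      Finset.sum_eq_zero, add_zero]
    intro k _
    rw [hG 0 (by omega) (by omega), hG 0 (by omega) (by omega), mul_zero, mul_zero, add_zero]
  have hmid : ∀ (a₀ : F) (a : Fin 3 → K), ∀ i ∈ Finset.Icc 4 ((q + 1) / 2), ∑ j : Fin (q + 1),
      algebraMap F K (a₀ + traceWord F q β a j) * (β ^ (j : ℕ)) ^ i = 0 := by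
    intro a₀ a i hi
    rw [Finset.mem_Icc] at hi
    rw [sum_add_traceWord_mul_pow hq hK hβ, hG 0 (by omega) (by omega), mul_zero, zero_add,
      Finset.sum_eq_zero]
    intro k _
    rw [hG 0 (by omega) (by omega), hG 1 (by omega) (by omega), mul_zero, mul_zero, add_zero]
  have hlow : ∀ (a₀ : F) (a : Fin 3 → K) (k : Fin 3), ∑ j : Fin (q + 1),
      algebraMap F K (a₀ + traceWord F q β a j) * (β ^ (j : ℕ)) ^ (k + 1 : ℕ) = a k ^ q := by
    intro a₀ a k
    rw [sum_add_traceWord_mul_pow hq hK hβ, hG 0 (by omega) (by omega), mul_zero, zero_add,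
      Finset.sum_eq_single k]
    · rw [hG 0 (by omega) (by omega), sum_root_pow_eq_one_of_dvd hq hβ ⟨1, by omega⟩, mul_zero, mul_one,
        zero_add]
    · intro l _ hl
      have hl' : (l : ℕ) ≠ k := fun h => hl (Fin.ext h)
      rw [hG 0 (by omega) (by omega), mul_zero, zero_add]
      rcases lt_or_gt_of_ne hl' with h | h
      · rw [hG 1 (by omega) (by omega), mul_zero]
      · rw [hG 0 (by omega) (by omega), mul_zero]
    · simp
  ext c
  constructor
  · rintro ⟨hc, hsum⟩
    rw [mem_classicalMDSCode_iff hq hβ h2 hK (by norm_num)] at hc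
    set c' : Fin (q + 1) → F := fun j => c j.castSucc with hc'
    -- The q-th power undoes the one in `hlow`, since Frobenius is an involution of K.
    set a : Fin 3 → K := fun k =>
      (∑ j : Fin (q + 1), algebraMap F K (c' j) * (β ^ (j : ℕ)) ^ (k + 1 : ℕ)) ^ q with ha
    set a₀ := ∑ j, c' j with ha₀
    set w : Fin (q + 1) → F := fun j => a₀ + traceWord F q β a j with hw
    have hsub : ∀ i, ∑ j : Fin (q + 1), algebraMap F K ((c' - w) j) * (β ^ (j : ℕ)) ^ i =
        (∑ j : Fin (q + 1), algebraMap F K (c' j) * (β ^ (j : ℕ)) ^ i) -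
          ∑ j : Fin (q + 1), algebraMap F K (w j) * (β ^ (j : ℕ)) ^ i := by
      intro i
      rw [← Finset.sum_sub_distrib]
      exact Finset.sum_congr rfl fun j _ => by rw [Pi.sub_apply, map_sub, sub_mul]
    have hhalf : ∀ i, 2 * i ≤ q + 1 →
        ∑ j : Fin (q + 1), algebraMap F K ((c' - w) j) * (β ^ (j : ℕ)) ^ i = 0 := by
      intro i hi
      rw [hsub]
      rcases Nat.eq_zero_or_pos i with rfl | hpos
      · rw [hzero]
        simp [ha₀]
      by_cases h4 : 4 ≤ i
      · have hmem : i ∈ Finset.Icc 4 ((q + 1) / 2) := Finset.mem_Icc.mpr ⟨h4, by omega⟩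
        rw [hmid a₀ a i hmem, hc i hmem, sub_zero]
      · obtain ⟨k, rfl⟩ : ∃ k : Fin 3, i = k + 1 := ⟨⟨i - 1, by omega⟩, by simp; omega⟩
        rw [hlow a₀ a k, ha, pow_card_pow_card_eq_self hq hK, sub_self]
    have hcw : c' - w = 0 := by
      refine eq_zero_of_forall_sum_eq_zero hβ _ fun i hi => ?_
      by_cases hi2 : 2 * i ≤ q + 1
      · exact hhalf i hi2
      · have h := hhalf (q + 1 - i) (by omega)
        have h' := sum_mul_pow_pow_card hq hβ (c' - w) (q + 1 - i)
        rw [h, zero_pow (by omega)] at h'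
        rw [h']
        refine Finset.sum_congr rfl fun j _ => ?_
        have hv := root_pow_card_add_one hβ (j : ℕ)
        rw [pow_sub₀ _ (ne_zero_of_pow_add_one hv) (by omega), hv, one_mul, inv_inv]
    refine ⟨(a₀, a), ?_⟩
    ext j
    refine Fin.lastCases ?_ (fun i => ?_) j
    · rw [Fin.sum_univ_castSucc] at hsum
      simp only [extendedTraceWord, LinearMap.coe_mk, AddHom.coe_mk, Fin.snoc_last]
      linear_combination -hsum
    · simp only [extendedTraceWord, LinearMap.coe_mk, AddHom.coe_mk, Fin.snoc_castSucc]
      exact (congrFun (sub_eq_zero.mp hcw) i).symm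
  · rintro ⟨⟨a₀, a⟩, rfl⟩
    constructor
    · rw [mem_classicalMDSCode_iff hq hβ h2 hK (by norm_num)]
      intro i hi
      simpa [extendedTraceWord] using hmid a₀ a i hi
    · rw [Fin.sum_univ_castSucc]
      simp only [extendedTraceWord, LinearMap.coe_mk, AddHom.coe_mk, Fin.snoc_castSucc,
        Fin.snoc_last]
      apply (algebraMap F K).injective
      have := hzero a₀ a
      simp only [pow_zero, mul_one] at this
      rw [map_add, map_sum, this, map_neg, map_zero, add_neg_cancel]

/-- The parameter a₀ pairs with y to a₀ times the difference between the sum of the first q + 1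
coordinates and the last one. -/
theorem mem_dualCode_range_extendedTraceWord_iff (hK : Module.finrank F K = 2) {β : K}
    (hβ : IsPrimitiveRoot β (q + 1)) (y : Fin (q + 1 + 1) → F) :
    y ∈ dualCode (LinearMap.range (extendedTraceWord F q β)) ↔
      (fun j : Fin (q + 1) => y j.castSucc) ∈ narrowSenseBCHCode F (q + 1) β 4 ∧
        y (Fin.last _) = ∑ j : Fin (q + 1), y j.castSucc := by
  rw [narrowSenseBCHCode_four_eq_dualCode hK hβ, mem_dualCode_iff, mem_dualCode_iff]
  have key : ∀ a₀ a, ∑ i, extendedTraceWord F q β (a₀, a) i * y i =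
      ∑ j : Fin (q + 1), traceWord F q β a j * y j.castSucc +
        a₀ * (∑ j : Fin (q + 1), y j.castSucc - y (Fin.last _)) := by
    intro a₀ a
    rw [Fin.sum_univ_castSucc]
    simp only [extendedTraceWord, LinearMap.coe_mk, AddHom.coe_mk, Fin.snoc_castSucc, Fin.snoc_last,
      add_mul, Finset.sum_add_distrib, ← Finset.mul_sum]
    ring
  constructor
  · intro h
    constructor
    · rintro _ ⟨a, rfl⟩
      have := h _ ⟨(0, a), rfl⟩
      rwa [key, zero_mul, add_zero] at this
    · have := h _ ⟨(1, 0), rfl⟩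
      rw [key, map_zero] at this
      simp only [Pi.zero_apply, zero_mul, Finset.sum_const_zero, zero_add, one_mul] at this
      exact (sub_eq_zero.mp this).symm
  · rintro ⟨h1, h2⟩ _ ⟨⟨a₀, a⟩, rfl⟩
    rw [key, h1 _ ⟨a, rfl⟩, h2, sub_self, mul_zero, add_zero]

end ClassicalMDSCode

/-! ### Dimensions and minimum distances. -/

section MinimumDistances

variable {F K : Type*} [Field F] [Field K] [Algebra F K] {q : ℕ}

open Classical in
theorem hammingNorm_extendedTraceWord (β : K) (a : F × (Fin 3 → K)) :
    hammingNorm (extendedTraceWord F q β a) =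
      hammingNorm (fun j => a.1 + traceWord F q β a.2 j) + if a.1 = 0 then 0 else 1 := by
  rw [hammingNorm_eq_castSucc_add]
  simp [extendedTraceWord]

variable [Fintype F]

theorem finrank_range_traceWord (hq : Fintype.card F = q) (h9 : 9 ≤ q)
    (hK : Module.finrank F K = 2) {β : K} (hβ : IsPrimitiveRoot β (q + 1)) :
    Module.finrank F (LinearMap.range (traceWord F q β)) = 6 := by
  have : Module.Finite F K := Module.finite_of_finrank_pos (by rw [hK]; norm_num)
  rw [LinearMap.finrank_range_of_inj (injective_traceWord hq h9 hK hβ), Module.finrank_pi_fintype]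
  simp [hK]

theorem finrank_range_extendedTraceWord (hq : Fintype.card F = q) (h9 : 9 ≤ q)
    (hK : Module.finrank F K = 2) {β : K} (hβ : IsPrimitiveRoot β (q + 1)) :
    Module.finrank F (LinearMap.range (extendedTraceWord F q β)) = 7 := by
  have : Module.Finite F K := Module.finite_of_finrank_pos (by rw [hK]; norm_num)
  rw [LinearMap.finrank_range_of_inj (injective_extendedTraceWord hq h9 hK hβ),
    Module.finrank_prod, Module.finrank_pi_fintype]
  simp [hK]

theorem hasMinDist_range_traceWord (hq : Fintype.card F = q) (hodd : Odd q) (h9 : 9 ≤ q)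
    (hK : Module.finrank F K = 2) {β : K} (hβ : IsPrimitiveRoot β (q + 1)) :
    HasMinDist (LinearMap.range (traceWord F q β)) (q - 5) := by
  classical
  rw [hasMinDist_iff]
  have hle : ∀ a : Fin 3 → K, a ≠ 0 → q - 5 ≤ hammingNorm (traceWord F q β a) := by
    intro a ha
    have := le_hammingNorm_add_traceWord hq hK hβ 0 a (Or.inr ha)
    simp only [zero_add] at this
    convert this
  constructor
  · obtain ⟨a, ha, hw⟩ := exists_hammingNorm_traceWord_le hq hodd h9 hK hβ
    refine ⟨_, ⟨a, rfl⟩, ?_, ?_⟩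
    · rw [ne_eq, ← map_zero (traceWord F q β)]
      exact fun h => ha (injective_traceWord hq h9 hK hβ h)
    · refine le_antisymm ?_ ?_
      · convert hw
      · convert hle a ha
  · rintro _ ⟨a, rfl⟩ hx
    have ha : a ≠ 0 := by rintro rfl; exact hx (map_zero _)
    convert hle a ha

open Classical in
theorem hasMinDist_range_extendedTraceWord (hq : Fintype.card F = q) (hodd : Odd q) (h9 : 9 ≤ q)
    (hK : Module.finrank F K = 2) {β : K} (hβ : IsPrimitiveRoot β (q + 1)) :
    HasMinDist (LinearMap.range (extendedTraceWord F q β)) (q - 5) := by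
  rw [hasMinDist_iff]
  have hle : ∀ a, a ≠ 0 → q - 5 ≤ hammingNorm (extendedTraceWord F q β a) := by
    intro a ha
    rw [hammingNorm_extendedTraceWord]
    refine (le_hammingNorm_add_traceWord hq hK hβ a.1 a.2 ?_).trans (Nat.le_add_right _ _)
    by_contra! hcon
    exact ha (Prod.ext hcon.1 hcon.2)
  constructor
  · obtain ⟨a, ha, hw⟩ := exists_hammingNorm_traceWord_le hq hodd h9 hK hβ
    have ha' : ((0 : F), a) ≠ 0 := fun h => ha (congrArg Prod.snd h)
    refine ⟨_, ⟨(0, a), rfl⟩, ?_, le_antisymm ?_ (hle _ ha')⟩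
    · rw [ne_eq, ← map_zero (extendedTraceWord F q β)]
      exact fun h => ha' (injective_extendedTraceWord hq h9 hK hβ h)
    · rw [hammingNorm_extendedTraceWord]
      simpa using hw
  · rintro _ ⟨a, rfl⟩ hx
    exact hle a (by rintro rfl; exact hx (map_zero _))

open Classical in
theorem hasMinDist_narrowSenseBCHCode (hq : Fintype.card F = q) (hodd : Odd q) (h9 : 9 ≤ q)
    (hK : Module.finrank F K = 2) {β : K} (hβ : IsPrimitiveRoot β (q + 1)) :
    HasMinDist (narrowSenseBCHCode F (q + 1) β 4) (if 4 ∣ q + 1 then 4 else 5) := by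
  rw [hasMinDist_iff]
  have hle : ∀ x ∈ narrowSenseBCHCode F (q + 1) β 4, x ≠ 0 →
      (if 4 ∣ q + 1 then 4 else 5) ≤ hammingNorm x := by
    intro x hx hx0
    by_contra hlt
    have hlt5 : hammingNorm x < 5 := by split_ifs at hlt <;> omega
    have h4 := (bch_coeff_three_mul_sum_ne_zero hq hβ hx hx0 (by omega)).1
    split_ifs at hlt with hd
    · omega
    · have hd' : 4 ∣ q - 1 := by
        obtain ⟨m, hm⟩ := hodd
        omega
      have := bch_hammingNorm_ne_four hq hd' h9 hβ hx hx0
      omega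
  refine ⟨?_, hle⟩
  split_ifs with hd
  · obtain ⟨c, hc, hc0, hw⟩ := exists_bch_word_four hq hK hβ hd
    have := hle c hc hc0
    rw [if_pos hd] at this
    exact ⟨c, hc, hc0, le_antisymm hw this⟩
  · have hd' : 4 ∣ q - 1 := by
      obtain ⟨m, hm⟩ := hodd
      omega
    obtain ⟨c, hc, hc0, hw⟩ := exists_bch_word_five hq h9 hK hβ hd'
    have := hle c hc hc0
    rw [if_neg hd] at this
    exact ⟨c, hc, hc0, le_antisymm hw this⟩

-- The appended coordinate is ∑ c, nonzero on every nonzero word of weight at most 7, so each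
-- minimal word gains exactly one.
open Classical in
theorem hasMinDist_dualCode_range_extendedTraceWord (hq : Fintype.card F = q)
    (hK : Module.finrank F K = 2) {β : K} (hβ : IsPrimitiveRoot β (q + 1)) {d : ℕ} (hd : d ≤ 6)
    (h : HasMinDist (narrowSenseBCHCode F (q + 1) β 4) d) :
    HasMinDist (dualCode (LinearMap.range (extendedTraceWord F q β))) (d + 1) := by
  rw [hasMinDist_iff] at h ⊢
  obtain ⟨⟨x, hx, hx0, hxd⟩, hle⟩ := h
  constructor
  · refine ⟨Fin.snoc (α := fun _ => F) x (∑ j, x j), ?_, ?_, ?_⟩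
    · rw [mem_dualCode_range_extendedTraceWord_iff hK hβ]
      simpa using hx
    · intro h
      apply hx0
      ext j
      have := congrFun h j.castSucc
      simpa using this
    · rw [hammingNorm_eq_castSucc_add]
      have := (bch_coeff_three_mul_sum_ne_zero hq hβ hx hx0 (by omega)).2
      simp [this, hxd]
  · intro y hy hy0
    rw [mem_dualCode_range_extendedTraceWord_iff hK hβ] at hy
    obtain ⟨hy1, hy2⟩ := hy
    have hy' : (fun j : Fin (q + 1) => y j.castSucc) ≠ 0 := by
      intro h
      apply hy0
      ext j
      refine Fin.lastCases ?_ (fun i => congrFun h i) j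
      rw [hy2]
      exact Finset.sum_eq_zero fun i _ => congrFun h i
    have hd1 := hle _ hy1 hy'
    rw [hammingNorm_eq_castSucc_add]
    split_ifs with h0
    · by_contra hlt
      exact (bch_coeff_three_mul_sum_ne_zero hq hβ hy1 hy' (by omega)).2 (by rw [← hy2, h0])
    · omega

end MinimumDistances

/-! ### Assembly of the parameters. -/

theorem mainTheorem10 {F K : Type*} [Field F] [Fintype F] [Field K] [Algebra F K]
    (q : ℕ) (hq : Fintype.card F = q) (hodd : Odd q) (hq9 : 9 ≤ q)
    (hK : Module.finrank F K = 2) (β : K) (hβ : IsPrimitiveRoot β (q + 1)) :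
    IsCodeWithParams (q + 2) 7 (q - 5) (extendedCode (classicalMDSCode F q β 4)) ∧
    (∃ d : ℕ,
      IsCodeWithParams (q + 2) (q - 5) d (dualCode (extendedCode (classicalMDSCode F q β 4))) ∧
      (4 ∣ q + 1 → d = 5) ∧
      (4 ∣ q - 1 → ¬ 3 ∣ q + 1 → d = 6) ∧
      (4 ∣ q - 1 → 3 ∣ q + 1 → (6 ≤ d ∧ d ≤ 7) ∧ (¬ 5 ∣ q → d = 6))) ∧
    IsCodeWithParams (q + 1) 6 (q - 5) (dualCode (narrowSenseBCHCode F (q + 1) β 4)) ∧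
    (∃ d : ℕ,
      IsCodeWithParams (q + 1) (q - 5) d (narrowSenseBCHCode F (q + 1) β 4) ∧
      (4 ∣ q + 1 → d = 4) ∧
      (4 ∣ q - 1 → ¬ 3 ∣ q + 1 → d = 5) ∧
      (4 ∣ q - 1 → 3 ∣ q + 1 → (5 ≤ d ∧ d ≤ 6) ∧ (¬ 5 ∣ q → d = 5))) := by
  have hmin := hasMinDist_narrowSenseBCHCode hq hodd hq9 hK hβ
  have hmin' := hasMinDist_dualCode_range_extendedTraceWord hq hK hβ
    (by split_ifs <;> norm_num) hmin
  have hnd : 4 ∣ q - 1 → ¬ 4 ∣ q + 1 := by omega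
  rw [extendedCode_classicalMDSCode_eq_range hq hodd hq9 hK hβ]
  refine ⟨⟨finrank_range_extendedTraceWord hq hq9 hK hβ,
    hasMinDist_range_extendedTraceWord hq hodd hq9 hK hβ⟩, ⟨_, ⟨?_, hmin'⟩, ?_⟩, ⟨?_, ?_⟩,
    ⟨_, ⟨?_, hmin⟩, ?_⟩⟩
  · rw [finrank_dualCode, finrank_range_extendedTraceWord hq hq9 hK hβ]
    omega
  · refine ⟨fun h => by rw [if_pos h], fun h _ => by rw [if_neg (hnd h)],
      fun h _ => by rw [if_neg (hnd h)]; simp⟩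
  · rw [narrowSenseBCHCode_four_eq_dualCode hK hβ, dualCode_dualCode,
      finrank_range_traceWord hq hq9 hK hβ]
  · rw [narrowSenseBCHCode_four_eq_dualCode hK hβ, dualCode_dualCode]
    exact hasMinDist_range_traceWord hq hodd hq9 hK hβ
  · rw [narrowSenseBCHCode_four_eq_dualCode hK hβ, finrank_dualCode,
      finrank_range_traceWord hq hq9 hK hβ]
    omega
  · refine ⟨fun h => by rw [if_pos h], fun h _ => by rw [if_neg (hnd h)],
      fun h _ => by rw [if_neg (hnd h)]; simp⟩
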